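/- Let $\alpha\in\mathbb{R}$ with $\alpha<1/3$ and let $T\in(0,\infty]$. Consider on $[0,T]$ (on $[0,\infty)$ if $T=\infty$) the equation driven by integrated Brownian motion $$X_t=\int_0^t \operatorname{sign}(X_s)\,|X_s|^{\alpha}\,ds+\int_0^t W_s\,ds,\qquad\text{i.e.}\qquad dX_t=\big(\operatorname{sign}(X_t)|X_t|^\alpha+W_t\big)\,dt,\quad X_0=0,$$ where $\operatorname{sign}(0)=0$ and the drift is taken to be $0$ at $0$. A weak solution is a filtered probability space $(\Omega,\mathcal F,(\mathcal F_t)_{t\ge0},\mathbb P)$ carrying a standard real $(\mathcal F_t)$-Brownian motion $W$ and an adapted, almost surely continuous real process $X$ such that almost surely, for all finite $t\le T$, $\int_0^t|X_s|^\alpha\mathbf 1_{\{X_s\ne0\}}\,ds<\infty$ and the equation holds at time $t$. Then weak uniqueness (uniqueness in law) fails: there exist two weak solutions $X$, $X'$ started at $0$ whose laws on path space over $[0,T]$ are different. Moreover, if $0<\alpha<1/3$, the drift $x\mapsto\operatorname{sign}(x)|x|^\alpha$ is globally $\alpha$-Hölder continuous on $\mathbb{R}$. (So weak uniqueness for such equations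 can fail for an $\alpha$-Hölder drift with any exponent $\alpha\in(0,1/3)$: the threshold $1/3$ is sharp.) -/

import Mathlib

open MeasureTheory ProbabilityTheory
open scoped NNReal ENNReal

/-- The Peano drift `b(x) = sign(x) |x|^α`, with `sign 0 = 0`, so that `b(0) = 0` for every `α`. -/
noncomputable def peanoDrift (α x : ℝ) : ℝ :=
  Real.sign x * |x| ^ α

/-- The time integral `∫₀ᵗ Y_s ds` of the path `s ↦ Y s ω`. -/
noncomputable def timeIntegral {Ω : Type*} (Y : ℝ≥0 → Ω → ℝ) (t : ℝ≥0) (ω : Ω) : ℝ :=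
  ∫ s in (0 : ℝ)..t, Y s.toNNReal ω

/-- `W` is a standard real Brownian motion relative to the filtration `ℱ`: it is a Brownian motion
(started at `0`, almost surely continuous), it is adapted, and its increments after time `s` are
independent of `ℱ s`. -/
structure IsFilteredBrownian {Ω : Type*} {mΩ : MeasurableSpace Ω} (P : Measure Ω)
    (ℱ : Filtration ℝ≥0 mΩ) (W : ℝ≥0 → Ω → ℝ) : Prop where
  isBrownian : IsBrownianReal W P
  adapted : Adapted ℱ W
  indep_increment : ∀ s t : ℝ≥0, s ≤ t →
    Indep (MeasurableSpace.comap (fun ω => W t ω - W s ω) inferInstance) (ℱ s) P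

/-- The filtered probability space `(Ω, P, ℱ)` with the processes `(W, X)` is a weak solution on the
time interval `{t : 0 ≤ t ≤ T, t < ∞}` of
`X_t = x + ∫₀ᵗ sign(X_s) |X_s|^α ds + ∫₀ᵗ W_s ds`, where `W` is a Brownian motion.
Only the values `X t` with `t ≤ T` matter; a process given on `[0, T]` is extended by
`X t = X (min t T)`. -/
structure IsWeakSolution {Ω : Type*} {mΩ : MeasurableSpace Ω} (α x : ℝ) (T : ℝ≥0∞)
    (P : Measure Ω) (ℱ : Filtration ℝ≥0 mΩ) (W X : ℝ≥0 → Ω → ℝ) : Prop where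
  isProbabilityMeasure : IsProbabilityMeasure P
  isFilteredBrownian : IsFilteredBrownian P ℱ W
  adapted : Adapted ℱ X
  continuous : ∀ᵐ ω ∂P, Continuous fun t => X t ω
  drift_integrable : ∀ᵐ ω ∂P, ∀ t : ℝ≥0, (t : ℝ≥0∞) ≤ T →
    IntervalIntegrable (fun s : ℝ => peanoDrift α (X s.toNNReal ω)) volume 0 t
  equation : ∀ᵐ ω ∂P, ∀ t : ℝ≥0, (t : ℝ≥0∞) ≤ T →
    X t ω = x + timeIntegral (fun s ω => peanoDrift α (X s ω)) t ω + timeIntegral W t ω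

/-- The law of the process `X` on the time interval `{t : 0 ≤ t ≤ T, t < ∞}`, as a measure on paths
with the σ-algebra generated by the coordinates. -/
noncomputable def pathLaw {Ω : Type*} {mΩ : MeasurableSpace Ω} (T : ℝ≥0∞) (P : Measure Ω)
    (X : ℝ≥0 → Ω → ℝ) : Measure ({t : ℝ≥0 // (t : ℝ≥0∞) ≤ T} → ℝ) :=
  P.map fun ω t => X t ω

/-- Weak uniqueness (uniqueness in law) on `[0, T]` for the equation started at `x`: any two weak
solutions, possibly on different filtered probability spaces, have the same law. -/
def WeakUniqueness (α x : ℝ) (T : ℝ≥0∞) : Prop :=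
  ∀ (Ω Ω' : Type) (mΩ : MeasurableSpace Ω) (mΩ' : MeasurableSpace Ω')
    (P : Measure Ω) (P' : Measure Ω') (ℱ : Filtration ℝ≥0 mΩ) (ℱ' : Filtration ℝ≥0 mΩ')
    (W X : ℝ≥0 → Ω → ℝ) (W' X' : ℝ≥0 → Ω' → ℝ),
    IsWeakSolution α x T P ℱ W X → IsWeakSolution α x T P' ℱ' W' X' →
      pathLaw T P X = pathLaw T P' X'

/-!
The drift is odd, so if `(W, X)` is a weak solution started at `0`, then so is `(-W, -X)`. It is
therefore enough to construct one weak solution that is almost surely positive at all small positive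
times: the event that a path is eventually positive along a fixed sequence of times decreasing to `0`
then has probability one for `X` and, if the laws agreed, also for `-X`. Solutions are constructed on
`[0, ∞)`, which covers every time interval at once.

Without noise, `x' = x ^ α` has the positive solution `C t ^ β` with `β = 1 / (1 - α)`, and
`∫₀ᵗ W` is of order `t ^ (3 / 2)`. The condition `α < 1 / 3` says exactly that `β < 3 / 2`, so that
the drift wins near `0`. The quantitative form is that `∫₀¹ s ^ (-β) |W_s| ds` has finite expectation
for `β < 3 / 2`, which gives `∫₀ᵗ |W_s| ds = o(t ^ β)` almost surely
(`exists_abs_integral_le_rpow`).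

The equation is solved path by path, by iterations in which every step is a causal functional of the
path of `W` (`IsCausal`); hence the solution is adapted to the natural filtration of `W`.

* For `0 ≤ α < 1` the drift is monotone. Iterating the integral equation from a supersolution gives a
  decreasing sequence, whose limit solves the equation with the right-continuous version of the drift
  (`maxSolution_eq`), and all iterates stay above the subsolution `c t ^ β`
  (`exists_rpow_le_peanoIter`). For `α = 0` the two versions of the drift differ at zeros of the
  solution, but these form a null set since `W ≠ -1` at almost every time.
* For `α < 0` the function `y = x ^ (1 - α)` satisfies `y' = (1 - α) (1 + y ^ γ W)` with
  `0 < γ < 1`. A causal lower barrier, linear at `0`, makes the right-hand side Lipschitz in `y` with a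
  constant of order `t ^ (γ - 1)`, which is integrable, so that Picard iteration converges
  (`tendsto_picard`); the solution stays above the barrier (`powBarrier_le_powSolution`).

Brownian motion is obtained from an isometry of `L²(ℝ)` into a Gaussian subspace of `L²(P)`
(`exists_isonormal_process`), with a continuous modification built from dyadic approximations by the
Kolmogorov–Chentsov argument (`exists_continuous_isPreBrownianReal`).
-/

open Filter Topology

/-! ### Gaussian processes with prescribed covariance -/

open Complex in
/-- The characteristic functional of an `L²` random variable depends continuously on it. -/
theorem continuous_integral_cexp_Lp {Ω : Type*} {mΩ : MeasurableSpace Ω} (P : Measure Ω)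
    [IsProbabilityMeasure P] :
    Continuous fun h : Lp ℝ 2 P => ∫ ω, cexp (h ω * I) ∂P := by
  have hint : ∀ h : Lp ℝ 2 P, Integrable (fun ω => cexp (h ω * I)) P := by
    intro h
    have hm : AEStronglyMeasurable (fun ω => cexp (h ω * I)) P := by
      have := (Lp.stronglyMeasurable h).measurable
      exact (by fun_prop : Measurable fun ω => cexp (h ω * I)).aestronglyMeasurable
    refine Integrable.of_bound hm 1 (Filter.Eventually.of_forall fun ω => ?_)
    rw [norm_exp_ofReal_mul_I]
  refine (LipschitzWith.of_dist_le_mul (K := 1) fun f g => ?_).continuous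
  rw [dist_eq_norm, dist_eq_norm, ← integral_sub (hint f) (hint g), NNReal.coe_one, one_mul]
  have hfg : MemLp (⇑(f - g)) 2 P := Lp.memLp _
  have h1 : ∀ᵐ ω ∂P, ‖cexp (f ω * I) - cexp (g ω * I)‖ ≤ ‖(f - g) ω‖ := by
    filter_upwards [Lp.coeFn_sub f g] with ω hω
    rw [hω, Pi.sub_apply]
    have : cexp (f ω * I) - cexp (g ω * I)
        = cexp (g ω * I) * (cexp (I * ((f ω - g ω : ℝ) : ℂ)) - 1) := by
      rw [mul_sub, ← Complex.exp_add, mul_one]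
      congr 2
      push_cast
      ring
    rw [this, norm_mul, norm_exp_ofReal_mul_I, one_mul]
    exact Real.norm_exp_I_mul_ofReal_sub_one_le
  calc ‖∫ ω, (cexp (f ω * I) - cexp (g ω * I)) ∂P‖
      ≤ ∫ ω, ‖(f - g) ω‖ ∂P := norm_integral_le_of_norm_le (hfg.integrable one_le_two).norm h1
    _ = (eLpNorm (f - g) 1 P).toReal := by
        rw [integral_norm_eq_lintegral_enorm hfg.1, eLpNorm_one_eq_lintegral_enorm]
    _ ≤ ‖f - g‖ := by
        rw [Lp.norm_def]
        refine ENNReal.toReal_mono (Lp.eLpNorm_ne_top _) ?_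
        exact eLpNorm_le_eLpNorm_of_exponent_le one_le_two hfg.1


/-- **Isonormal Gaussian process.** Every real Hilbert space embeds isometrically into the square
integrable random variables of some probability space, with centred Gaussian images. -/
theorem exists_isonormal_process (H : Type) [NormedAddCommGroup H] [InnerProductSpace ℝ H]
    [CompleteSpace H] :
    ∃ (Ω : Type) (_ : MeasurableSpace Ω) (P : Measure Ω) (_ : IsProbabilityMeasure P)
      (J : H →ₗᵢ[ℝ] Lp ℝ 2 P), ∀ f, HasLaw (J f) (gaussianReal 0 (‖f‖₊ ^ 2)) P := by
  classical
  obtain ⟨s, b, -⟩ := exists_hilbertBasis ℝ H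
  obtain ⟨Ω, mΩ, P, Z, hZm, hZ, hind, hP⟩ := exists_iid s (gaussianReal 0 1)
  refine ⟨Ω, mΩ, P, hP, ?_⟩
  have hZg : ∀ i, HasGaussianLaw (Z i) P := fun i => (hZ i).hasGaussianLaw
  have hL : ∀ i, MemLp (Z i) 2 P := fun i => (hZg i).memLp_two
  have hmean : ∀ i, P[Z i] = 0 := fun i => by
    rw [(hZ i).integral_eq, integral_id_gaussianReal]
  have hvar : ∀ i, ∫ ω, Z i ω ^ 2 ∂P = 1 := fun i => by
    rw [← variance_of_integral_eq_zero (hZm i).aemeasurable (hmean i), (hZ i).variance_eq,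
      variance_id_gaussianReal, NNReal.coe_one]
  have hinner : ∀ i j, inner ℝ ((hL i).toLp (Z i)) ((hL j).toLp (Z j)) = ∫ ω, Z i ω * Z j ω ∂P := by
    intro i j
    rw [L2.inner_def]
    refine integral_congr_ae ?_
    filter_upwards [(hL i).coeFn_toLp, (hL j).coeFn_toLp] with ω h1 h2
    rw [h1, h2]
    simp [mul_comm]
  have horth : Orthonormal ℝ fun i => (hL i).toLp (Z i) := by
    rw [orthonormal_iff_ite]
    intro i j
    rw [hinner]
    split_ifs with hij
    · subst hij
      simpa [sq] using hvar i
    · have := (hind.indepFun hij).integral_mul_eq_mul_integral (hZm i).aestronglyMeasurable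
        (hZm j).aestronglyMeasurable
      simpa [hmean] using this
  let J : H →ₗᵢ[ℝ] Lp ℝ 2 P :=
    horth.orthogonalFamily.linearIsometry.comp b.repr.toLinearIsometry
  refine ⟨J, ?_⟩
  -- On the closed span of the `Z i` the characteristic functional is the Gaussian one.
  let G : Set (Lp ℝ 2 P) :=
    {h | ∫ ω, Complex.exp (h ω * Complex.I) ∂P = Complex.exp (-((‖h‖ ^ 2 / 2 : ℝ) : ℂ))}
  have hGc : IsClosed G :=
    isClosed_eq (continuous_integral_cexp_Lp P) (by fun_prop)
  have hspan : (Submodule.span ℝ (Set.range fun i => (hL i).toLp (Z i)) : Set (Lp ℝ 2 P)) ⊆ G := by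
    intro h hh
    obtain ⟨c, rfl⟩ := Finsupp.mem_span_range_iff_exists_finsupp.1 hh
    set h := c.sum fun i a => a • (hL i).toLp (Z i) with hdef
    have hae : h =ᵐ[P] fun ω => ∑ i : c.support, c i * Z i ω := by
      have h1 : (h : Ω → ℝ) =ᵐ[P] ∑ i ∈ c.support, ⇑(c i • (hL i).toLp (Z i)) :=
        Lp.coeFn_finsetSum _ _
      have h2 : ∀ᵐ ω ∂P, ∀ i ∈ c.support, (c i • (hL i).toLp (Z i)) ω = c i * Z i ω := by
        refine (ae_ball_iff c.support.countable_toSet).2 ?_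
        intro i _
        filter_upwards [Lp.coeFn_smul (c i) ((hL i).toLp (Z i)), (hL i).coeFn_toLp] with ω h3 h4
        rw [h3, Pi.smul_apply, h4, smul_eq_mul]
      filter_upwards [h1, h2] with ω h3 h4
      rw [h3, Finset.sum_apply, Finset.sum_congr rfl h4]
      exact (Finset.sum_coe_sort c.support fun i => c i * Z i ω).symm
    have hg : HasGaussianLaw (fun ω => ∑ i : c.support, c i * Z i ω) P := by
      refine iIndepFun.hasGaussianLaw_fun_sum (fun i => (hZg i).fun_smul (c i)) ?_
      exact (hind.precomp (g := fun i : c.support => (i : s)) Subtype.val_injective).comp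
        (fun i x => c i * x) (fun i => measurable_const_mul _)
    have hgh : HasGaussianLaw h P := hg.congr hae.symm
    have hm0 : P[h] = 0 := by
      rw [integral_congr_ae hae, integral_finsetSum]
      · exact Finset.sum_eq_zero fun i _ => by rw [integral_const_mul, hmean, mul_zero]
      · exact fun i _ => ((hL i).integrable one_le_two).const_mul _
    have hv : Var[h; P] = ‖h‖ ^ 2 := by
      rw [variance_of_integral_eq_zero hgh.aemeasurable hm0, ← real_inner_self_eq_norm_sq,
        L2.inner_def]
      simp [sq]
    have hlaw := hgh.map_eq_gaussianReal
    have hchar := charFun_gaussianReal (μ := P[h]) (v := Var[h; P].toNNReal) 1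
    rw [← hlaw, charFun_apply_real, integral_map hgh.aemeasurable (by fun_prop)] at hchar
    simp only [Complex.ofReal_one, one_mul] at hchar
    rw [Set.mem_ofPred_eq, hchar, hm0, hv, Real.coe_toNNReal _ (sq_nonneg _)]
    congr 1
    push_cast
    ring
  have hJG : ∀ f, J f ∈ G := by
    intro f
    refine closure_minimal hspan hGc ?_
    have : HasSum (fun i => b.repr f i • (hL i).toLp (Z i)) (J f) :=
      horth.orthogonalFamily.hasSum_linearIsometry (b.repr f)
    refine mem_closure_of_tendsto this (Filter.Eventually.of_forall fun t => ?_)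
    exact Submodule.sum_mem _ fun i _ =>
      Submodule.smul_mem _ _ (Submodule.subset_span (Set.mem_range_self i))
  intro f
  have hmf : AEMeasurable (J f) P := (Lp.aestronglyMeasurable _).aemeasurable
  refine ⟨hmf, ?_⟩
  have := Measure.isProbabilityMeasure_map hmf
  refine Measure.ext_of_charFun ?_
  ext t
  rw [charFun_gaussianReal, charFun_apply_real, integral_map hmf (by fun_prop)]
  have h1 := hJG (t • f)
  rw [Set.mem_ofPred_eq, map_smul] at h1
  have h2 : ∫ ω, Complex.exp ((t • J f : Lp ℝ 2 P) ω * Complex.I) ∂P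
      = ∫ ω, Complex.exp (t * (J f) ω * Complex.I) ∂P := by
    refine integral_congr_ae ?_
    filter_upwards [Lp.coeFn_smul t (J f)] with ω hω
    rw [hω, Pi.smul_apply, smul_eq_mul]
    push_cast
    rfl
  rw [← h2, h1, norm_smul, J.norm_map, mul_pow, Real.norm_eq_abs, sq_abs]
  congr 1
  push_cast
  simp
  ring

/-- Some probability space carries a process with the finite dimensional laws of Brownian motion. -/
theorem exists_isPreBrownianReal :
    ∃ (Ω : Type) (_ : MeasurableSpace Ω) (P : Measure Ω) (B : ℝ≥0 → Ω → ℝ),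
      (∀ t, Measurable (B t)) ∧ IsPreBrownianReal B P := by
  obtain ⟨Ω, mΩ, P, hP, J, hJ⟩ := exists_isonormal_process (Lp ℝ 2 (volume : Measure ℝ))
  let v : ℝ≥0 → Lp ℝ 2 (volume : Measure ℝ) := fun t =>
    indicatorConstLp 2 (measurableSet_Ioc (a := (0 : ℝ)) (b := t)) measure_Ioc_lt_top.ne 1
  have hv : ∀ s t : ℝ≥0, s ≤ t → inner ℝ (v s) (v t) = (s : ℝ) := by
    intro s t hst
    have h1 : Set.Ioc (0 : ℝ) s ∩ Set.Ioc (0 : ℝ) t = Set.Ioc (0 : ℝ) s :=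
      Set.inter_eq_left.2 (Set.Ioc_subset_Ioc_right (by exact_mod_cast hst))
    rw [L2.real_inner_indicatorConstLp_one_indicatorConstLp_one measurableSet_Ioc measurableSet_Ioc
      measure_Ioc_lt_top.ne measure_Ioc_lt_top.ne, h1]
    simp
  refine ⟨Ω, mΩ, P, fun t => J (v t), fun t => (Lp.stronglyMeasurable _).measurable, ?_⟩
  have hmean : ∀ t, P[J (v t)] = 0 := fun t => by
    rw [(hJ _).integral_eq, integral_id_gaussianReal]
  refine IsGaussianProcess.isPreBrownianReal_of_covariance ⟨fun I => ⟨?_⟩⟩ hmean ?_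
  · refine isGaussian_of_map_eq_gaussianReal fun L =>
      ⟨0, ‖∑ i : I, L (Pi.single i 1) • v i‖₊ ^ 2, ?_⟩
    · have hae : (fun ω => L (I.restrict fun t => J (v t) ω))
          =ᵐ[P] J (∑ i : I, L (Pi.single i 1) • v i) := by
        have h1 := Lp.coeFn_finsetSum Finset.univ fun i : I => L (Pi.single i 1) • J (v i)
        have h2 : ∀ᵐ ω ∂P, ∀ i : I,
            (L (Pi.single i 1) • J (v i)) ω = L (Pi.single i 1) * J (v i) ω :=
          ae_all_iff.2 fun i => Lp.coeFn_smul _ _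
        simp_rw [map_sum, map_smul]
        filter_upwards [h1, h2] with ω h3 h4
        rw [h3, Finset.sum_apply, Finset.sum_congr rfl fun i _ => h4 i,
          ← ContinuousLinearMap.coe_coe, LinearMap.pi_apply_eq_sum_univ]
        refine Finset.sum_congr rfl fun i _ => ?_
        rw [smul_eq_mul, mul_comm]
        simp only [ContinuousLinearMap.coe_coe, Finset.restrict]
        congr 2
        ext j
        simp [Pi.single_apply, eq_comm]
      have hm : Measurable fun ω => I.restrict fun t => J (v t) ω :=
        measurable_pi_lambda _ fun i => (Lp.stronglyMeasurable (J (v i))).measurable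
      rw [Measure.map_map (by fun_prop) hm]
      exact (Measure.map_congr hae).trans (hJ _).map_eq
  · intro s t hst
    rw [covariance_eq_sub (Lp.memLp _) (Lp.memLp _), hmean, zero_mul, sub_zero, ← hv s t hst,
      ← J.inner_map_map, L2.inner_def]
    refine integral_congr_ae (Filter.Eventually.of_forall fun ω => ?_)
    simp only [Pi.mul_apply, RCLike.inner_apply, conj_trivial]
    exact mul_comm _ _

/-! ### Continuous Brownian motion -/

/-- The value of the path `b` at the last point of the grid `2⁻ⁿ ℕ` before `t`. -/
noncomputable def dyadicApprox (b : ℝ≥0 → ℝ) (n : ℕ) (t : ℝ≥0) : ℝ :=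
  b (⌊t * 2 ^ n⌋₊ / 2 ^ n)

/-- The increments of `b` over neighbouring points of the grids `2⁻ⁿ ℕ` decay geometrically,
locally uniformly. -/
def HasDyadicDecay (b : ℝ≥0 → ℝ) : Prop :=
  ∀ N : ℕ, ∃ C : ℝ, 0 ≤ C ∧ ∀ n k : ℕ, k < N * 2 ^ n →
    |b ((k + 1 : ℕ) / 2 ^ n) - b (k / 2 ^ n)| ≤ C * (9 / 10) ^ n

theorem dyadicApprox_sub_le_of_decay {b : ℝ≥0 → ℝ} {N : ℕ} {C : ℝ} (hC : 0 ≤ C)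
    (h : ∀ n k : ℕ, k < N * 2 ^ n →
      |b ((k + 1 : ℕ) / 2 ^ n) - b (k / 2 ^ n)| ≤ C * (9 / 10) ^ n)
    (n : ℕ) {s t : ℝ≥0} (hst : s ≤ t) (ht : t < N) (hd : (t : ℝ) - s ≤ (1 / 2) ^ n) :
    |dyadicApprox b n t - dyadicApprox b n s| ≤ C * (9 / 10) ^ n := by
  have hpow : (0 : ℝ≥0) < 2 ^ n := by positivity
  have h1 : ⌊s * 2 ^ n⌋₊ ≤ ⌊t * 2 ^ n⌋₊ := by gcongr
  have h2 : ⌊t * 2 ^ n⌋₊ ≤ ⌊s * 2 ^ n⌋₊ + 1 := by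
    rw [← Nat.floor_add_one (by positivity)]
    refine Nat.floor_le_floor ?_
    rw [← NNReal.coe_le_coe]
    push_cast
    have : ((t : ℝ) - s) * 2 ^ n ≤ (1 / 2) ^ n * 2 ^ n := by gcongr
    rw [← mul_pow] at this
    norm_num at this
    linarith
  have h3 : ⌊t * 2 ^ n⌋₊ < N * 2 ^ n := by
    rw [Nat.floor_lt (by positivity)]
    push_cast
    gcongr
  unfold dyadicApprox
  obtain h4 | h4 : ⌊t * 2 ^ n⌋₊ = ⌊s * 2 ^ n⌋₊ ∨ ⌊t * 2 ^ n⌋₊ = ⌊s * 2 ^ n⌋₊ + 1 := by omega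
  · rw [h4, sub_self, abs_zero]
    positivity
  · rw [h4]
    exact h n _ (by omega)

theorem dyadicApprox_succ_sub_le_of_decay {b : ℝ≥0 → ℝ} {N : ℕ} {C : ℝ} (hC : 0 ≤ C)
    (h : ∀ n k : ℕ, k < N * 2 ^ n →
      |b ((k + 1 : ℕ) / 2 ^ n) - b (k / 2 ^ n)| ≤ C * (9 / 10) ^ n)
    (n : ℕ) {t : ℝ≥0} (ht : t < N) :
    |dyadicApprox b (n + 1) t - dyadicApprox b n t| ≤ C * (9 / 10) ^ (n + 1) := by
  set s : ℝ≥0 := ⌊t * 2 ^ n⌋₊ / 2 ^ n with hs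
  have hpow : (0 : ℝ≥0) < 2 ^ n := by positivity
  have hfl : (⌊t * 2 ^ n⌋₊ : ℝ≥0) ≤ t * 2 ^ n := Nat.floor_le (by positivity)
  have hst : s ≤ t := by rwa [hs, div_le_iff₀ hpow]
  have hms : s * 2 ^ (n + 1) = (2 * ⌊t * 2 ^ n⌋₊ : ℕ) := by
    rw [hs, pow_succ]
    push_cast
    field_simp
  -- `s` lies on the finer grid, and `t` is less than two fine steps away from it
  have h1 : ⌊t * 2 ^ (n + 1)⌋₊ < 2 * ⌊t * 2 ^ n⌋₊ + 2 := by
    rw [Nat.floor_lt (by positivity)]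
    have := Nat.lt_floor_add_one (t * 2 ^ n)
    rw [pow_succ, ← mul_assoc]
    push_cast
    calc t * 2 ^ n * 2 < (⌊t * 2 ^ n⌋₊ + 1) * 2 := by gcongr
      _ = _ := by ring
  have h2 : 2 * ⌊t * 2 ^ n⌋₊ ≤ ⌊t * 2 ^ (n + 1)⌋₊ := by
    rw [Nat.le_floor_iff (by positivity), ← hms]
    gcongr
  have h3 : ⌊t * 2 ^ (n + 1)⌋₊ < N * 2 ^ (n + 1) := by
    rw [Nat.floor_lt (by positivity)]
    push_cast
    gcongr
  have hb : dyadicApprox b n t = b ((2 * ⌊t * 2 ^ n⌋₊ : ℕ) / 2 ^ (n + 1)) := by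
    rw [← hms, mul_div_cancel_right₀ _ (by positivity)]
    rfl
  rw [hb, dyadicApprox]
  obtain h4 | h4 : ⌊t * 2 ^ (n + 1)⌋₊ = 2 * ⌊t * 2 ^ n⌋₊ ∨
      ⌊t * 2 ^ (n + 1)⌋₊ = 2 * ⌊t * 2 ^ n⌋₊ + 1 := by omega
  · rw [h4, sub_self, abs_zero]
    positivity
  · rw [h4]
    exact h (n + 1) _ (by omega)

/-- The deterministic half of the Kolmogorov–Chentsov argument: a path with geometrically decaying
dyadic increments extends from the dyadic points to a continuous path. -/
theorem HasDyadicDecay.exists_continuous_limit {b : ℝ≥0 → ℝ} (h : HasDyadicDecay b) :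
    ∃ w : ℝ≥0 → ℝ, Continuous w ∧ ∀ t, Tendsto (fun n => dyadicApprox b n t) atTop (𝓝 (w t)) := by
  choose C hC h using h
  have hcau : ∀ t, CauchySeq fun n => dyadicApprox b n t := by
    intro t
    obtain ⟨N, hN⟩ := exists_nat_gt t
    refine cauchySeq_of_le_geometric (9 / 10) (C N * (9 / 10)) (by norm_num) fun n => ?_
    rw [dist_comm, Real.dist_eq]
    refine (dyadicApprox_succ_sub_le_of_decay (hC N) (h N) n hN).trans_eq ?_
    ring
  choose w hw using fun t => cauchySeq_tendsto_of_complete (hcau t)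
  have happrox : ∀ (N : ℕ) (t : ℝ≥0), t < N → ∀ n,
      |dyadicApprox b n t - w t| ≤ 9 * C N * (9 / 10) ^ n := by
    intro N t hN n
    have := dist_le_of_le_geometric_of_tendsto (9 / 10) (C N * (9 / 10)) (by norm_num)
      (fun n => by
        rw [dist_comm, Real.dist_eq]
        refine (dyadicApprox_succ_sub_le_of_decay (hC N) (h N) n hN).trans_eq ?_
        ring) (hw t) n
    rw [Real.dist_eq] at this
    refine this.trans_eq ?_
    ring
  have hmod : ∀ (N : ℕ) (s t : ℝ≥0), s ≤ t → t < N → ∀ n : ℕ, (t : ℝ) - s ≤ (1 / 2) ^ n →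
      |w t - w s| ≤ 19 * C N * (9 / 10) ^ n := by
    intro N s t hst ht n hd
    have h1 := abs_le.1 (happrox N t ht n)
    have h2 := abs_le.1 (happrox N s (hst.trans_lt ht) n)
    have h3 := abs_le.1 (dyadicApprox_sub_le_of_decay (hC N) (h N) n hst ht hd)
    rw [abs_le]
    constructor <;> linarith [h1.1, h1.2, h2.1, h2.2, h3.1, h3.2]
  refine ⟨w, ?_, hw⟩
  rw [Metric.continuous_iff]
  intro t ε hε
  obtain ⟨N, hN⟩ := exists_nat_gt (t + 1)
  have hlim : Tendsto (fun n : ℕ => 19 * C N * (9 / 10 : ℝ) ^ n) atTop (𝓝 0) := by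
    simpa using (tendsto_pow_atTop_nhds_zero_of_lt_one (by norm_num : (0 : ℝ) ≤ 9 / 10)
      (by norm_num)).const_mul (19 * C N)
  obtain ⟨n, hn⟩ := (hlim.eventually (gt_mem_nhds hε)).exists
  refine ⟨(1 / 2) ^ n, by positivity, fun s hs => ?_⟩
  have hpow1 : ((1 : ℝ) / 2) ^ n ≤ 1 := pow_le_one₀ (by norm_num) (by norm_num)
  rw [NNReal.dist_eq] at hs
  have hs' := abs_lt.1 hs
  have hsN : s < N := by
    rw [← NNReal.coe_lt_coe] at hN ⊢
    push_cast at hN ⊢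
    linarith [hs'.2]
  have htN : t < N := lt_of_le_of_lt (by simp) hN
  rw [Real.dist_eq]
  rcases le_total s t with hst | hst
  · rw [abs_sub_comm]
    exact (hmod N s t hst htN n (by linarith [hs'.1])).trans_lt hn
  · exact (hmod N t s hst hsN n (by linarith [hs'.2])).trans_lt hn

theorem lintegral_pow_four_gaussianReal (v : ℝ≥0) :
    ∫⁻ x, ENNReal.ofReal (x ^ 4) ∂(gaussianReal 0 v)
      = ENNReal.ofReal (v ^ 2) * ∫⁻ x, ENNReal.ofReal (x ^ 4) ∂(gaussianReal 0 1) := by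
  have h := gaussianReal_map_const_mul (μ := 0) (v := 1) (√v)
  have h1 : gaussianReal 0 v = (gaussianReal 0 1).map (√v * ·) := by
    rw [h, mul_zero]
    congr 1
    ext
    simp
  rw [h1, lintegral_map (by fun_prop) (by fun_prop), ← lintegral_const_mul _ (by fun_prop)]
  refine lintegral_congr fun x => ?_
  rw [← ENNReal.ofReal_mul (by positivity), mul_pow, 
    show (√(v : ℝ)) ^ 4 = ((√(v : ℝ)) ^ 2) ^ 2 by ring, Real.sq_sqrt (NNReal.coe_nonneg v)]

theorem lintegral_pow_four_gaussianReal_lt_top :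
    ∫⁻ x, ENNReal.ofReal (x ^ 4) ∂(gaussianReal 0 1) < ∞ := by
  have h : MemLp id (4 : ℝ≥0) (gaussianReal 0 1) := memLp_id_gaussianReal 4
  have := h.integrable_norm_pow (p := 4) (by norm_num)
  have h2 := this.lintegral_lt_top
  refine lt_of_le_of_lt (lintegral_mono fun x => ?_) h2
  refine ENNReal.ofReal_le_ofReal ?_
  simp only [id, Real.norm_eq_abs]
  rw [← abs_pow]
  exact le_abs_self _

theorem ProbabilityTheory.IsPreBrownianReal.lintegral_sub_pow_four {Ω : Type*} {mΩ : MeasurableSpace Ω}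
    {P : Measure Ω} {B : ℝ≥0 → Ω → ℝ} (hB : IsPreBrownianReal B P) (s t : ℝ≥0) :
    ∫⁻ ω, ENNReal.ofReal ((B t ω - B s ω) ^ 4) ∂P = ENNReal.ofReal (((t : ℝ) - s) ^ 2) *
      ∫⁻ x, ENNReal.ofReal (x ^ 4) ∂(gaussianReal 0 1) := by
  have h := hB.hasLaw_sub t s
  have h1 : ∫⁻ ω, ENNReal.ofReal ((B t ω - B s ω) ^ 4) ∂P
      = ∫⁻ x, ENNReal.ofReal (x ^ 4) ∂(gaussianReal 0 (nndist t.1 s.1)) := by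
    rw [← h.map_eq, lintegral_map' (by fun_prop) h.aemeasurable]
    rfl
  rw [h1, lintegral_pow_four_gaussianReal, coe_nndist, Real.dist_eq, sq_abs]
  rfl

/-- Almost surely the dyadic increments of a pre-Brownian motion decay geometrically. The fourth
moments of the `N 2ⁿ` increments of level `n` are of order `4⁻ⁿ`, so that the sum of all of them,
weighted by `(10 / 9) ^ (4 n) < 2ⁿ`, has finite expectation. -/
theorem ProbabilityTheory.IsPreBrownianReal.ae_hasDyadicDecay {Ω : Type*} {mΩ : MeasurableSpace Ω}
    {P : Measure Ω} {B : ℝ≥0 → Ω → ℝ} (hB : IsPreBrownianReal B P) (hBm : ∀ t, Measurable (B t)) :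
    ∀ᵐ ω ∂P, HasDyadicDecay fun t => B t ω := by
  refine ae_all_iff.2 fun N => ?_
  set c := ∫⁻ x, ENNReal.ofReal (x ^ 4) ∂(gaussianReal 0 1) with hc
  let a : ℕ → ℕ → Ω → ℝ := fun n k ω => B ((k + 1 : ℕ) / 2 ^ n) ω - B (k / 2 ^ n) ω
  have ham : ∀ n k, Measurable (a n k) := fun n k => (hBm _).sub (hBm _)
  let S : Ω → ℝ≥0∞ := fun ω => ∑' n, ∑ k ∈ Finset.range (N * 2 ^ n),
    ENNReal.ofReal ((10 / 9) ^ (4 * n)) * ENNReal.ofReal (a n k ω ^ 4)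
  have hSm : Measurable S := by
    refine Measurable.tsum fun n => Finset.measurable_sum _ fun k _ => ?_
    have := ham n k
    fun_prop
  have hS : ∫⁻ ω, S ω ∂P ≠ ∞ := by
    have h1 : ∀ n, ∫⁻ ω, ∑ k ∈ Finset.range (N * 2 ^ n),
        ENNReal.ofReal ((10 / 9) ^ (4 * n)) * ENNReal.ofReal (a n k ω ^ 4) ∂P
        = ENNReal.ofReal (N * (5000 / 6561) ^ n) * c := by
      intro n
      rw [lintegral_finsetSum _ fun k _ => by have := ham n k; fun_prop]
      have h2 : ∀ k ∈ Finset.range (N * 2 ^ n), ∫⁻ ω, ENNReal.ofReal ((10 / 9) ^ (4 * n)) *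
          ENNReal.ofReal (a n k ω ^ 4) ∂P
          = ENNReal.ofReal ((10 / 9) ^ (4 * n) * ((1 / 2) ^ n) ^ 2) * c := by
        intro k _
        rw [lintegral_const_mul _ (by have := ham n k; fun_prop), hB.lintegral_sub_pow_four,
          ← mul_assoc, ← ENNReal.ofReal_mul (by positivity)]
        congr 4
        push_cast
        rw [one_div, inv_pow]
        ring
      rw [Finset.sum_congr rfl h2, Finset.sum_const, Finset.card_range, nsmul_eq_mul, ← mul_assoc,
        ← ENNReal.ofReal_natCast, ← ENNReal.ofReal_mul (by positivity)]
      congr 2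
      push_cast
      rw [pow_mul, ← pow_mul (1 / 2 : ℝ), mul_comm n 2, pow_mul, mul_assoc, ← mul_pow, ← mul_pow]
      norm_num
    rw [lintegral_tsum fun n => (Finset.measurable_sum _ fun k _ => by
      have := ham n k; fun_prop).aemeasurable]
    simp_rw [h1]
    rw [ENNReal.tsum_mul_right]
    refine ENNReal.mul_ne_top ?_ lintegral_pow_four_gaussianReal_lt_top.ne
    refine Summable.tsum_ofReal_ne_top ?_
    exact (summable_geometric_of_lt_one (by norm_num) (by norm_num)).mul_left _
  filter_upwards [ae_lt_top hSm hS] with ω hω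
  refine ⟨(S ω).toReal + 1, by positivity, fun n k hk => ?_⟩
  have h1 : ENNReal.ofReal ((10 / 9) ^ (4 * n)) * ENNReal.ofReal (a n k ω ^ 4) ≤ S ω :=
    (Finset.single_le_sum (f := fun k => ENNReal.ofReal ((10 / 9) ^ (4 * n)) *
      ENNReal.ofReal (a n k ω ^ 4)) (fun _ _ => zero_le) (Finset.mem_range.2 hk)).trans
      (ENNReal.le_tsum n)
  rw [← ENNReal.ofReal_mul (by positivity), ENNReal.ofReal_le_iff_le_toReal hω.ne] at h1
  set A := (S ω).toReal with hA
  have hA0 : 0 ≤ A := ENNReal.toReal_nonneg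
  -- `A ≤ (A + 1) ^ 4` avoids taking a fourth root
  have h3 : ((10 / 9) ^ n * |a n k ω|) ^ 4 ≤ (A + 1) ^ 4 := by
    calc ((10 / 9) ^ n * |a n k ω|) ^ 4 = (10 / 9) ^ (4 * n) * a n k ω ^ 4 := by
          rw [mul_pow, ← pow_mul, mul_comm n 4, Even.pow_abs (by decide)]
      _ ≤ A + 1 := h1.trans (by linarith)
      _ ≤ (A + 1) ^ 4 := le_self_pow₀ (by linarith) (by norm_num)
  have h4 : (10 / 9) ^ n * |a n k ω| ≤ A + 1 :=
    le_of_pow_le_pow_left₀ (by norm_num) (by positivity) h3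
  have h5 : ((10 : ℝ) / 9) ^ n * (9 / 10) ^ n = 1 := by
    rw [← mul_pow]
    norm_num
  calc |a n k ω| = ((10 / 9) ^ n * |a n k ω|) * (9 / 10) ^ n := by
        rw [mul_right_comm, h5, one_mul]
    _ ≤ _ := by gcongr

/-- At a fixed time the dyadic approximations of a pre-Brownian motion converge almost surely. -/
theorem ProbabilityTheory.IsPreBrownianReal.ae_tendsto_dyadicApprox {Ω : Type*} {mΩ : MeasurableSpace Ω}
    {P : Measure Ω} {B : ℝ≥0 → Ω → ℝ} (hB : IsPreBrownianReal B P) (hBm : ∀ t, Measurable (B t))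
    (t : ℝ≥0) :
    ∀ᵐ ω ∂P, Tendsto (fun n => dyadicApprox (fun t => B t ω) n t) atTop (𝓝 (B t ω)) := by
  let d : ℕ → Ω → ℝ := fun n ω => B t ω - dyadicApprox (fun t => B t ω) n t
  have hdm : ∀ n, Measurable (d n) := fun n => (hBm _).sub (hBm _)
  have hS : ∫⁻ ω, ∑' n, ENNReal.ofReal (d n ω ^ 4) ∂P ≠ ∞ := by
    rw [lintegral_tsum fun n => by have := hdm n; fun_prop]
    have h1 : ∀ n, ∫⁻ ω, ENNReal.ofReal (d n ω ^ 4) ∂P ≤ ENNReal.ofReal ((1 / 4) ^ n) *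
        ∫⁻ x, ENNReal.ofReal (x ^ 4) ∂(gaussianReal 0 1) := by
      intro n
      have h2 := hB.lintegral_sub_pow_four (⌊t * 2 ^ n⌋₊ / 2 ^ n) t
      refine h2.le.trans ?_
      gcongr
      have h3 : (⌊t * 2 ^ n⌋₊ : ℝ≥0) ≤ t * 2 ^ n := Nat.floor_le (by positivity)
      have h4 := Nat.lt_floor_add_one (t * 2 ^ n)
      rw [← NNReal.coe_le_coe] at h3
      rw [← NNReal.coe_lt_coe] at h4
      push_cast at h3 h4 ⊢
      set m : ℝ := (⌊t * 2 ^ n⌋₊ : ℝ)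
      have hp : (0 : ℝ) < 2 ^ n := by positivity
      have h5 : (t : ℝ) - m / 2 ^ n = (t * 2 ^ n - m) / 2 ^ n := by field_simp
      have h6 : ((t : ℝ) * 2 ^ n - m) ^ 2 ≤ 1 := by
        rw [sq_le_one_iff₀ (by linarith)]
        linarith
      rw [h5, div_pow, div_pow, one_pow, ← pow_mul, mul_comm n 2, pow_mul,
        show (2 : ℝ) ^ 2 = 4 by norm_num]
      gcongr
    refine ne_top_of_le_ne_top ?_ (ENNReal.tsum_le_tsum h1)
    rw [ENNReal.tsum_mul_right]
    refine ENNReal.mul_ne_top ?_ lintegral_pow_four_gaussianReal_lt_top.ne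
    exact (summable_geometric_of_lt_one (by norm_num) (by norm_num)).tsum_ofReal_ne_top
  have hSm : Measurable fun ω => ∑' n, ENNReal.ofReal (d n ω ^ 4) :=
    Measurable.tsum fun n => by have := hdm n; fun_prop
  filter_upwards [ae_lt_top hSm hS] with ω hω
  have h1 := ENNReal.tendsto_atTop_zero_of_tsum_ne_top hω.ne
  have h2 : Tendsto (fun n => d n ω ^ 4) atTop (𝓝 0) := by
    have := (ENNReal.tendsto_toReal ENNReal.zero_ne_top).comp h1
    simp only [Function.comp_def, ENNReal.toReal_zero] at this
    refine this.congr fun n => ENNReal.toReal_ofReal (by positivity)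
  have h3 : Tendsto (fun n => d n ω) atTop (𝓝 0) := by
    refine tendsto_zero_iff_abs_tendsto_zero _ |>.2 ?_
    have hc : Continuous fun x : ℝ => √√x := by fun_prop
    have := (hc.tendsto' 0 0 (by simp)).comp h2
    refine this.congr fun n => ?_
    rw [Function.comp_apply, Function.comp_apply, show d n ω ^ 4 = (d n ω ^ 2) ^ 2 by ring,
      Real.sqrt_sq (sq_nonneg _), Real.sqrt_sq_eq_abs]
  have h4 := h3.const_sub (B t ω)
  rw [sub_zero] at h4
  exact h4.congr fun n => sub_sub_cancel _ _

/-- **Existence of Brownian motion**, with all paths continuous. -/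
theorem exists_continuous_isPreBrownianReal :
    ∃ (Ω : Type) (_ : MeasurableSpace Ω) (P : Measure Ω) (W : ℝ≥0 → Ω → ℝ),
      (∀ t, Measurable (W t)) ∧ (∀ ω, Continuous fun t => W t ω) ∧ IsPreBrownianReal W P := by
  classical
  obtain ⟨Ω, mΩ, P, B, hBm, hB⟩ := exists_isPreBrownianReal
  have hdec := hB.ae_hasDyadicDecay hBm
  obtain ⟨N, hN, hNm, hN0⟩ := exists_measurable_superset_of_null (ae_iff.1 hdec)
  have hgood : ∀ ω ∉ N, HasDyadicDecay fun t => B t ω := fun ω hω => by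
    by_contra h
    exact hω (hN h)
  choose w hwc hw using fun ω : {ω // ω ∉ N} => (hgood ω ω.2).exists_continuous_limit
  let W : ℝ≥0 → Ω → ℝ := fun t ω => if h : ω ∈ N then 0 else w ⟨ω, h⟩ t
  refine ⟨Ω, mΩ, P, W, fun t => ?_, fun ω => ?_, ?_⟩
  · refine measurable_of_tendsto_metrizable
      (f := fun n => Nᶜ.indicator fun ω => dyadicApprox (fun t => B t ω) n t)
      (fun n => (hBm _).indicator hNm.compl) ?_
    rw [tendsto_pi_nhds]
    intro ω
    by_cases h : ω ∈ N
    · simp [W, h]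
    · simpa [W, h] using hw ⟨ω, h⟩ t
  · by_cases h : ω ∈ N
    · simpa [W, h] using continuous_const
    · simpa [W, h] using hwc ⟨ω, h⟩
  · refine hB.congr fun t => ?_
    filter_upwards [measure_eq_zero_iff_ae_notMem.1 hN0, hB.ae_tendsto_dyadicApprox hBm t]
      with ω h h1
    simpa [W, h] using tendsto_nhds_unique h1 (hw ⟨ω, h⟩ t)

/-! ### The natural filtration and almost sure path properties -/

/-- A Brownian motion is a Brownian motion relative to its natural filtration. -/
theorem ProbabilityTheory.IsBrownianReal.isFilteredBrownian_natural {Ω : Type*}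
    {mΩ : MeasurableSpace Ω} {P : Measure Ω} {W : ℝ≥0 → Ω → ℝ} (hW : IsBrownianReal W P)
    (hWm : ∀ t, StronglyMeasurable (W t)) :
    IsFilteredBrownian P (Filtration.natural W hWm) W where
  isBrownian := hW
  adapted := (Filtration.stronglyAdapted_natural hWm).adapted
  indep_increment s t hst := by
    have h := hW.toIsPreBrownianReal.indepFun_shift s
    rw [IndepFun_iff_Indep] at h
    refine indep_of_indep_of_le_left (indep_of_indep_of_le_right h ?_) ?_
    · refine iSup₂_le fun j hj => ?_
      rintro _ ⟨A, hA, rfl⟩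
      refine ⟨(fun x : Set.Iic s → ℝ => x ⟨j, hj⟩) ⁻¹' A, measurable_pi_apply _ hA, rfl⟩
    · rintro _ ⟨A, hA, rfl⟩
      refine ⟨(fun x : ℝ≥0 → ℝ => x (t - s)) ⁻¹' A, measurable_pi_apply _ hA, ?_⟩
      ext ω
      simp [add_tsub_cancel_of_le hst]

theorem IsFilteredBrownian.neg {Ω : Type*} {mΩ : MeasurableSpace Ω} {P : Measure Ω}
    {ℱ : Filtration ℝ≥0 mΩ} {W : ℝ≥0 → Ω → ℝ} (h : IsFilteredBrownian P ℱ W) :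
    IsFilteredBrownian P ℱ (-W) where
  isBrownian := h.isBrownian.neg
  adapted t := (h.adapted t).neg
  indep_increment s t hst := by
    refine indep_of_indep_of_le_left (h.indep_increment s t hst) ?_
    rintro _ ⟨A, hA, rfl⟩
    refine ⟨(fun x => -x) ⁻¹' A, measurable_neg hA, ?_⟩
    ext ω
    simp [neg_add_eq_sub]

theorem measurable_uncurry_toNNReal {Ω : Type*} {mΩ : MeasurableSpace Ω} {W : ℝ≥0 → Ω → ℝ}
    (hWm : ∀ t, Measurable (W t)) (hWc : ∀ ω, Continuous fun t => W t ω) :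
    Measurable (Function.uncurry fun (ω : Ω) (s : ℝ) => W s.toNNReal ω) := by
  have h := measurable_uncurry_of_continuous_of_measurable (u := fun (s : ℝ) (ω : Ω) => W s.toNNReal ω)
    (fun ω => (hWc ω).comp continuous_real_toNNReal) (fun s => hWm _)
  exact h.comp measurable_swap

/-- Almost surely, Brownian motion spends no time at a given level. -/
theorem ProbabilityTheory.IsPreBrownianReal.ae_ae_ne {Ω : Type*} {mΩ : MeasurableSpace Ω}
    {P : Measure Ω} {W : ℝ≥0 → Ω → ℝ} (hW : IsPreBrownianReal W P)
    (hWm : ∀ t, Measurable (W t)) (hWc : ∀ ω, Continuous fun t => W t ω) (a : ℝ) :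
    ∀ᵐ ω ∂P, ∀ᵐ s ∂(volume.restrict (Set.Ioi (0 : ℝ))), W s.toNNReal ω ≠ a := by
  have := hW.isGaussianProcess.isProbabilityMeasure
  have hm := measurable_uncurry_toNNReal hWm hWc
  have hset : MeasurableSet {p : Ω × ℝ | W p.2.toNNReal p.1 ≠ a} :=
    hm (measurableSet_singleton a).compl
  rw [Measure.ae_ae_comm hset]
  refine (ae_restrict_iff' measurableSet_Ioi).2 (Eventually.of_forall fun s hs => ?_)
  have hlaw := hW.hasLaw_eval s.toNNReal
  have hs' : s.toNNReal ≠ 0 := by simpa using hs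
  have := nullSingletonClass_gaussianReal (μ := 0) hs'
  rw [ae_iff]
  simp only [not_not]
  have h1 : {ω | W s.toNNReal ω = a} = W s.toNNReal ⁻¹' {a} := rfl
  rw [h1, ← Measure.map_apply (hWm _) (measurableSet_singleton a), hlaw.map_eq]
  exact measure_singleton a

theorem lintegral_abs_gaussianReal (v : ℝ≥0) :
    ∫⁻ x, ENNReal.ofReal |x| ∂(gaussianReal 0 v)
      = ENNReal.ofReal √v * ∫⁻ x, ENNReal.ofReal |x| ∂(gaussianReal 0 1) := by
  have h := gaussianReal_map_const_mul (μ := 0) (v := 1) (√v)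
  have h1 : gaussianReal 0 v = (gaussianReal 0 1).map (√v * ·) := by
    rw [h, mul_zero]
    congr 1
    ext
    simp
  rw [h1, lintegral_map (by fun_prop) (by fun_prop), ← lintegral_const_mul _ (by fun_prop)]
  refine lintegral_congr fun x => ?_
  rw [← ENNReal.ofReal_mul (by positivity), abs_mul, abs_of_nonneg (Real.sqrt_nonneg _)]

/-- Since `E |W_s| = C √s`, the path `|W|` is integrable at `0` against `s ^ (-β)` for `β < 3 / 2`. -/
theorem ProbabilityTheory.IsPreBrownianReal.ae_integrableOn_rpow_mul {Ω : Type*}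
    {mΩ : MeasurableSpace Ω}
    {P : Measure Ω} {W : ℝ≥0 → Ω → ℝ} (hW : IsPreBrownianReal W P)
    (hWm : ∀ t, Measurable (W t)) (hWc : ∀ ω, Continuous fun t => W t ω) {β : ℝ}
    (hβ : β < 3 / 2) :
    ∀ᵐ ω ∂P, IntegrableOn (fun s : ℝ => s ^ (-β) * |W s.toNNReal ω|) (Set.Ioc 0 1) := by
  have := hW.isGaussianProcess.isProbabilityMeasure
  have hm := measurable_uncurry_toNNReal hWm hWc
  have hg : Measurable fun p : Ω × ℝ => ENNReal.ofReal (p.2 ^ (-β) * |W p.2.toNNReal p.1|) := by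
    have h1 : Measurable fun p : Ω × ℝ => |W p.2.toNNReal p.1| := measurable_abs.comp hm
    exact ((measurable_snd.pow_const _).mul h1).ennreal_ofReal
  have hfin : ∫⁻ ω, (∫⁻ s in Set.Ioc (0 : ℝ) 1, ENNReal.ofReal (s ^ (-β) * |W s.toNNReal ω|)) ∂P
      ≠ ∞ := by
    rw [lintegral_lintegral_swap hg.aemeasurable]
    have h1 : ∀ s ∈ Set.Ioc (0 : ℝ) 1, ∫⁻ ω, ENNReal.ofReal (s ^ (-β) * |W s.toNNReal ω|) ∂P
        = ENNReal.ofReal (s ^ (1 / 2 - β)) * ∫⁻ x, ENNReal.ofReal |x| ∂(gaussianReal 0 1) := by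
      intro s hs
      have hlaw := hW.hasLaw_eval s.toNNReal
      have h2 : ∀ ω, ENNReal.ofReal (s ^ (-β) * |W s.toNNReal ω|)
          = ENNReal.ofReal (s ^ (-β)) * ENNReal.ofReal |W s.toNNReal ω| := fun ω =>
        ENNReal.ofReal_mul (Real.rpow_nonneg hs.1.le _)
      have h3 : ∫⁻ ω, ENNReal.ofReal |W s.toNNReal ω| ∂P
          = ∫⁻ x, ENNReal.ofReal |x| ∂(gaussianReal 0 s.toNNReal) := by
        rw [← hlaw.map_eq, lintegral_map (by fun_prop) (hWm _)]
      simp_rw [h2]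
      rw [lintegral_const_mul _ (by have := hWm s.toNNReal; fun_prop), h3,
        lintegral_abs_gaussianReal, ← mul_assoc, ← ENNReal.ofReal_mul (Real.rpow_nonneg hs.1.le _),
        Real.coe_toNNReal _ hs.1.le, Real.sqrt_eq_rpow, ← Real.rpow_add hs.1]
      congr 3
      ring
    rw [setLIntegral_congr_fun measurableSet_Ioc h1, lintegral_mul_const _ (by fun_prop)]
    refine ENNReal.mul_ne_top ?_ ?_
    · have h2 : IntegrableOn (fun s : ℝ => s ^ (1 / 2 - β)) (Set.Ioc 0 1) := by
        have := intervalIntegral.intervalIntegrable_rpow' (a := 0) (b := 1) (r := 1 / 2 - β)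
          (by linarith)
        rwa [intervalIntegrable_iff_integrableOn_Ioc_of_le zero_le_one] at this
      exact h2.lintegral_lt_top.ne
    · have h2 : Integrable (fun x : ℝ => |x|) (gaussianReal 0 1) :=
        ((memLp_id_gaussianReal 1).integrable le_rfl).abs
      exact h2.lintegral_lt_top.ne
  filter_upwards [ae_lt_top hg.lintegral_prod_right' hfin] with ω hω
  refine ⟨?_, ?_⟩
  · have h1 : Measurable fun s : ℝ => W s.toNNReal ω := hm.of_uncurry_left
    exact (by fun_prop : Measurable fun s : ℝ => s ^ (-β) * |W s.toNNReal ω|).aestronglyMeasurable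
  · rw [hasFiniteIntegral_iff_ofReal]
    · exact hω
    · refine (ae_restrict_iff' measurableSet_Ioc).2 (Eventually.of_forall fun s hs => ?_)
      exact mul_nonneg (Real.rpow_nonneg hs.1.le _) (abs_nonneg _)

/-! ### Causal functionals of paths -/

/-- A functional on real paths, indexed by time, is causal if its value at time `t ≥ 0` depends only
on the path on `[0, t]`, and if it turns jointly measurable processes into jointly measurable
processes. -/
structure IsCausal (Ψ : (ℝ → ℝ) → ℝ → ℝ) : Prop where
  measurable : ∀ (Ω : Type) (_ : MeasurableSpace Ω) (Z : Ω → ℝ → ℝ),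
    Measurable (Function.uncurry Z) → Measurable (Function.uncurry fun ω t => Ψ (Z ω) t)
  congr : ∀ (w w' : ℝ → ℝ) (t : ℝ), 0 ≤ t → (∀ s ∈ Set.Icc 0 t, w s = w' s) → Ψ w t = Ψ w' t

namespace IsCausal

variable {Ψ Φ : (ℝ → ℝ) → ℝ → ℝ}

theorem eval : IsCausal fun w t => w t where
  measurable _ _ _ hZ := hZ
  congr _ _ t ht h := h t ⟨ht, le_rfl⟩

theorem time {g : ℝ → ℝ} (hg : Measurable g) : IsCausal fun _ t => g t where
  measurable _ _ _ _ := hg.comp measurable_snd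
  congr _ _ _ _ _ := rfl

theorem map₂ {F : ℝ → ℝ → ℝ} (hF : Measurable (Function.uncurry F)) (hΨ : IsCausal Ψ)
    (hΦ : IsCausal Φ) : IsCausal fun w t => F (Ψ w t) (Φ w t) where
  measurable Ω m Z hZ :=
    hF.comp ((hΨ.measurable Ω m Z hZ).prodMk (hΦ.measurable Ω m Z hZ))
  congr w w' t ht h := by rw [hΨ.congr w w' t ht h, hΦ.congr w w' t ht h]

theorem map {f : ℝ → ℝ} (hf : Measurable f) (hΨ : IsCausal Ψ) : IsCausal fun w t => f (Ψ w t) where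
  measurable Ω m Z hZ := hf.comp (hΨ.measurable Ω m Z hZ)
  congr w w' t ht h := by rw [hΨ.congr w w' t ht h]

theorem integral (hΨ : IsCausal Ψ) : IsCausal fun w t => ∫ s in (0 : ℝ)..t, Ψ w s where
  measurable Ω m Z hZ := by
    have h := hΨ.measurable Ω m Z hZ
    have key : ∀ A : Set (ℝ × ℝ), MeasurableSet A →
        Measurable fun p : Ω × ℝ => ∫ s, {s | (s, p.2) ∈ A}.indicator (Ψ (Z p.1)) s := by
      intro A hA
      refine StronglyMeasurable.measurable
        (StronglyMeasurable.integral_prod_right'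
          (f := fun q : (Ω × ℝ) × ℝ => {s | (s, q.1.2) ∈ A}.indicator (Ψ (Z q.1.1)) q.2) ?_)
      have hset : MeasurableSet {q : (Ω × ℝ) × ℝ | (q.2, q.1.2) ∈ A} :=
        (measurable_snd.prodMk (measurable_snd.comp measurable_fst)) hA
      have hf : Measurable fun q : (Ω × ℝ) × ℝ => Ψ (Z q.1.1) q.2 :=
        h.comp ((measurable_fst.comp measurable_fst).prodMk measurable_snd)
      exact (hf.indicator hset).stronglyMeasurable
    have h1 := key {q | 0 < q.1 ∧ q.1 ≤ q.2} ((measurableSet_lt measurable_const measurable_fst).inter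
      (measurableSet_le measurable_fst measurable_snd))
    have h2 := key {q | q.2 < q.1 ∧ q.1 ≤ 0} ((measurableSet_lt measurable_snd measurable_fst).inter
      (measurableSet_le measurable_fst measurable_const))
    convert h1.sub h2 using 1
    ext p
    rw [Pi.sub_apply, Function.uncurry, intervalIntegral,
      ← integral_indicator measurableSet_Ioc, ← integral_indicator measurableSet_Ioc]
    rfl
  congr w w' t ht h := by
    refine intervalIntegral.integral_congr fun s hs => ?_
    rw [Set.uIcc_of_le ht] at hs
    exact hΨ.congr w w' s hs.1 fun r hr => h r ⟨hr.1, hr.2.trans hs.2⟩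

theorem limsup {Ψ : ℕ → (ℝ → ℝ) → ℝ → ℝ} (h : ∀ n, IsCausal (Ψ n)) :
    IsCausal fun w t => Filter.limsup (fun n => Ψ n w t) atTop where
  measurable Ω m Z hZ := Measurable.limsup fun n => (h n).measurable Ω m Z hZ
  congr w w' t ht hw := by simp_rw [fun n => (h n).congr w w' t ht hw]

/-- A causal functional of an adapted continuous process is adapted: its value at time `t` is a
measurable functional of the process stopped at `t`. -/
theorem adapted (hΨ : IsCausal Ψ) {Ω : Type} {mΩ : MeasurableSpace Ω} {ℱ : Filtration ℝ≥0 mΩ}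
    {W : ℝ≥0 → Ω → ℝ} (hW : Adapted ℱ W) (hWc : ∀ ω, Continuous fun t => W t ω) :
    Adapted ℱ fun (t : ℝ≥0) ω => Ψ (fun s => W s.toNNReal ω) t := by
  intro t
  have h1 : Measurable[(ℱ t).prod inferInstance] (Function.uncurry fun (ω : Ω) (s : ℝ) =>
      W (min s.toNNReal t) ω) :=
    @measurable_uncurry_toNNReal Ω (ℱ t) (fun s => W (min s t))
      (fun s => (hW _).mono (ℱ.mono (min_le_right _ _)) le_rfl)
      (fun ω => (hWc ω).comp (continuous_id.min continuous_const))
  have h2 := hΨ.measurable Ω (ℱ t) _ h1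
  have h3 : Measurable[ℱ t] fun ω => Ψ (fun s => W (min s.toNNReal t) ω) (t : ℝ) :=
    h2.comp measurable_prodMk_right
  convert h3 using 2 with ω
  refine hΨ.congr _ _ t t.2 fun s hs => ?_
  rw [min_eq_left]
  exact Real.toNNReal_le_iff_le_coe.2 hs.2

end IsCausal

/-! ### Monotone iteration for nonnegative exponents -/

/-- The right-continuous version of the Peano drift for `α ≥ 0`; it differs from `peanoDrift` only
at `0` for `α = 0`, where its value is `1`. -/
noncomputable def upperPeanoDrift (α x : ℝ) : ℝ :=
  if 0 ≤ x then x ^ α else -(-x) ^ α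

theorem upperPeanoDrift_of_ne_zero (α : ℝ) {x : ℝ} (hx : x ≠ 0) :
    upperPeanoDrift α x = peanoDrift α x := by
  unfold upperPeanoDrift peanoDrift
  rcases lt_or_gt_of_ne hx with h | h
  · rw [if_neg (not_le.2 h), Real.sign_of_neg h, abs_of_neg h, neg_one_mul]
  · rw [if_pos h.le, Real.sign_of_pos h, abs_of_pos h, one_mul]

theorem upperPeanoDrift_of_pos {α : ℝ} (hα : 0 < α) (x : ℝ) :
    upperPeanoDrift α x = peanoDrift α x := by
  rcases eq_or_ne x 0 with rfl | hx
  · simp [upperPeanoDrift, peanoDrift, Real.zero_rpow hα.ne']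
  · exact upperPeanoDrift_of_ne_zero α hx

theorem monotone_upperPeanoDrift {α : ℝ} (hα : 0 ≤ α) : Monotone (upperPeanoDrift α) := by
  intro x y hxy
  unfold upperPeanoDrift
  split_ifs with hx hy hy
  · exact Real.rpow_le_rpow hx hxy hα
  · linarith
  · linarith [Real.rpow_nonneg (by linarith : 0 ≤ -x) α, Real.rpow_nonneg hy α]
  · exact neg_le_neg (Real.rpow_le_rpow (by linarith) (by linarith) hα)

theorem abs_upperPeanoDrift_le {α : ℝ} (hα : 0 ≤ α) (hα1 : α ≤ 1) (x : ℝ) :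
    |upperPeanoDrift α x| ≤ 1 + |x| := by
  have key : ∀ y : ℝ, 0 ≤ y → y ^ α ≤ 1 + y := by
    intro y hy
    calc y ^ α ≤ (1 + y) ^ α := Real.rpow_le_rpow hy (by linarith) hα
      _ ≤ (1 + y) ^ (1 : ℝ) := Real.rpow_le_rpow_of_exponent_le (by linarith) hα1
      _ = 1 + y := Real.rpow_one _
  unfold upperPeanoDrift
  split_ifs with hx
  · rw [abs_of_nonneg (Real.rpow_nonneg hx _), abs_of_nonneg hx]
    exact key x hx
  · rw [abs_neg, abs_of_nonneg (Real.rpow_nonneg (by linarith) _), abs_of_neg (not_le.1 hx)]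
    exact key (-x) (by linarith)

theorem continuousWithinAt_upperPeanoDrift {α : ℝ} (hα : 0 ≤ α) (x : ℝ) :
    ContinuousWithinAt (upperPeanoDrift α) (Set.Ici x) x := by
  rcases le_or_gt 0 x with hx | hx
  · refine (Real.continuous_rpow_const hα).continuousWithinAt.congr (fun y hy => ?_) ?_
    · exact if_pos (hx.trans hy)
    · exact if_pos hx
  · refine ContinuousAt.continuousWithinAt ?_
    have h1 : ContinuousAt (fun y : ℝ => -(-y) ^ α) x :=
      ((Real.continuous_rpow_const hα).comp continuous_neg).neg.continuousAt
    refine h1.congr ?_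
    filter_upwards [gt_mem_nhds hx] with y hy
    exact (if_neg (not_le.2 hy)).symm

theorem IsCausal.measurable_apply {Ψ : (ℝ → ℝ) → ℝ → ℝ} (hΨ : IsCausal Ψ) {w : ℝ → ℝ}
    (hw : Measurable w) : Measurable (Ψ w) :=
  (hΨ.measurable Unit inferInstance (fun _ => w) (hw.comp measurable_snd)).of_uncurry_left
    (x := ())

/-- Monotone iteration for `u' = upperPeanoDrift α u + w`, `u 0 = 0`, from a supersolution. -/
noncomputable def peanoIter (α : ℝ) : ℕ → (ℝ → ℝ) → ℝ → ℝ
  | 0, w, t => Real.exp t * ∫ s in (0 : ℝ)..t, (1 + |w s|)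
  | n + 1, w, t => ∫ s in (0 : ℝ)..t, (upperPeanoDrift α (peanoIter α n w s) + w s)

theorem isCausal_peanoIter {α : ℝ} (hα : 0 ≤ α) (n : ℕ) : IsCausal (peanoIter α n) := by
  induction n with
  | zero =>
    exact (IsCausal.time Real.measurable_exp).map₂ (F := fun x y => x * y) measurable_mul
      (IsCausal.eval.map (f := fun x => 1 + |x|) (by fun_prop)).integral
  | succ n ih =>
    exact ((ih.map (monotone_upperPeanoDrift hα).measurable).map₂ (F := fun x y => x + y)
      measurable_add IsCausal.eval).integral

/-- The limit of the monotone iteration: a solution of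
`u' = upperPeanoDrift α u + w`, `u 0 = 0`. -/
noncomputable def maxSolution (α : ℝ) (w : ℝ → ℝ) (t : ℝ) : ℝ :=
  limsup (fun n => peanoIter α n w t) atTop

theorem isCausal_maxSolution {α : ℝ} (hα : 0 ≤ α) : IsCausal (maxSolution α) :=
  IsCausal.limsup (isCausal_peanoIter hα)

section MonotoneIteration

variable {α : ℝ} {w : ℝ → ℝ}

theorem continuous_peanoIter_zero (hw : Continuous w) : Continuous (peanoIter α 0 w) := by
  have h : Continuous fun s => 1 + |w s| := by fun_prop
  exact Real.continuous_exp.mul (intervalIntegral.continuous_primitive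
    (fun a b => h.intervalIntegrable a b) 0)

theorem integral_le_peanoIter_zero (hw : Continuous w) {t : ℝ} (ht : 0 ≤ t) :
    ∫ s in (0 : ℝ)..t, (1 + peanoIter α 0 w s + |w s|) ≤ peanoIter α 0 w t := by
  have hg : Continuous fun s => 1 + |w s| := by fun_prop
  have hU := continuous_peanoIter_zero (α := α) hw
  have hd : ∀ s, HasDerivAt (peanoIter α 0 w)
      (peanoIter α 0 w s + Real.exp s * (1 + |w s|)) s := fun s =>
    (Real.hasDerivAt_exp s).mul (hg.integral_hasStrictDerivAt 0 s).hasDerivAt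
  have hc : Continuous fun s => peanoIter α 0 w s + Real.exp s * (1 + |w s|) := by fun_prop
  have h1 := intervalIntegral.integral_eq_sub_of_hasDerivAt (fun s _ => hd s)
    (hc.intervalIntegrable 0 t)
  have h0 : peanoIter α 0 w 0 = 0 := by simp [peanoIter]
  rw [h0, sub_zero] at h1
  rw [← h1]
  refine intervalIntegral.integral_mono_on ht (Continuous.intervalIntegrable (by fun_prop) _ _)
    (hc.intervalIntegrable _ _) fun s hs => ?_
  have h2 : 1 ≤ Real.exp s := Real.one_le_exp hs.1
  nlinarith [abs_nonneg (w s)]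

theorem intervalIntegrable_upperPeanoDrift_add (hα : 0 ≤ α) (hα1 : α ≤ 1) (hw : Continuous w)
    {u : ℝ → ℝ} (hu : Measurable u) (hb : ∀ s, 0 ≤ s → |u s| ≤ peanoIter α 0 w s) {t : ℝ}
    (ht : 0 ≤ t) :
    IntervalIntegrable (fun s => upperPeanoDrift α (u s) + w s) volume 0 t := by
  have hU := continuous_peanoIter_zero (α := α) hw
  have h1 : IntervalIntegrable (fun s => 1 + peanoIter α 0 w s + |w s|) volume 0 t :=
    Continuous.intervalIntegrable (by fun_prop) _ _
  refine h1.mono_fun' ?_ ?_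
  · exact (((monotone_upperPeanoDrift hα).measurable.comp hu).add hw.measurable).aestronglyMeasurable
  · rw [Set.uIoc_of_le ht]
    refine (ae_restrict_iff' measurableSet_Ioc).2 (Eventually.of_forall fun s hs => ?_)
    simp only [Real.norm_eq_abs]
    linarith [abs_add_le (upperPeanoDrift α (u s)) (w s), abs_upperPeanoDrift_le hα hα1 (u s),
      hb s hs.1.le]

theorem abs_integral_upperPeanoDrift_add_le (hα : 0 ≤ α) (hα1 : α ≤ 1) (hw : Continuous w)
    {u : ℝ → ℝ} (hb : ∀ s, 0 ≤ s → |u s| ≤ peanoIter α 0 w s) {t : ℝ}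
    (ht : 0 ≤ t) :
    |∫ s in (0 : ℝ)..t, (upperPeanoDrift α (u s) + w s)| ≤ peanoIter α 0 w t := by
  have hU := continuous_peanoIter_zero (α := α) hw
  refine le_trans ?_ (integral_le_peanoIter_zero hw ht)
  rw [← Real.norm_eq_abs]
  refine intervalIntegral.norm_integral_le_of_norm_le ht
    (Eventually.of_forall fun s hs => ?_) (Continuous.intervalIntegrable (by fun_prop) _ _)
  rw [Real.norm_eq_abs]
  linarith [abs_add_le (upperPeanoDrift α (u s)) (w s), abs_upperPeanoDrift_le hα hα1 (u s),
    hb s hs.1.le]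

theorem abs_peanoIter_le (hα : 0 ≤ α) (hα1 : α ≤ 1) (hw : Continuous w) (n : ℕ) :
    ∀ t, 0 ≤ t → |peanoIter α n w t| ≤ peanoIter α 0 w t := by
  induction n with
  | zero =>
    intro t ht
    refine (abs_of_nonneg ?_).le
    refine mul_nonneg (Real.exp_pos _).le (intervalIntegral.integral_nonneg ht fun s _ => ?_)
    positivity
  | succ n ih => exact fun t ht => abs_integral_upperPeanoDrift_add_le hα hα1 hw ih ht

theorem intervalIntegrable_peanoIter (hα : 0 ≤ α) (hα1 : α ≤ 1) (hw : Continuous w) (n : ℕ)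
    {t : ℝ} (ht : 0 ≤ t) :
    IntervalIntegrable (fun s => upperPeanoDrift α (peanoIter α n w s) + w s) volume 0 t :=
  intervalIntegrable_upperPeanoDrift_add hα hα1 hw
    ((isCausal_peanoIter hα n).measurable_apply hw.measurable) (abs_peanoIter_le hα hα1 hw n) ht

theorem antitone_peanoIter (hα : 0 ≤ α) (hα1 : α ≤ 1) (hw : Continuous w) {t : ℝ} (ht : 0 ≤ t) :
    Antitone fun n => peanoIter α n w t := by
  refine antitone_nat_of_succ_le fun n => ?_
  induction n generalizing t with
  | zero => exact (le_abs_self _).trans (abs_peanoIter_le hα hα1 hw 1 t ht)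
  | succ n ih =>
    refine intervalIntegral.integral_mono_on ht (intervalIntegrable_peanoIter hα hα1 hw (n + 1) ht)
      (intervalIntegrable_peanoIter hα hα1 hw n ht) fun s hs => ?_
    have := monotone_upperPeanoDrift hα (ih hs.1)
    linarith

theorem tendsto_peanoIter (hα : 0 ≤ α) (hα1 : α ≤ 1) (hw : Continuous w) {t : ℝ} (ht : 0 ≤ t) :
    Tendsto (fun n => peanoIter α n w t) atTop (𝓝 (maxSolution α w t)) := by
  have h := tendsto_atTop_ciInf (antitone_peanoIter hα hα1 hw ht)
    ⟨-peanoIter α 0 w t, by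
      rintro _ ⟨n, rfl⟩
      exact (abs_le.1 (abs_peanoIter_le hα hα1 hw n t ht)).1⟩
  rw [maxSolution, h.limsup_eq]
  exact h

theorem maxSolution_le_peanoIter (hα : 0 ≤ α) (hα1 : α ≤ 1) (hw : Continuous w) {t : ℝ}
    (ht : 0 ≤ t) (n : ℕ) : maxSolution α w t ≤ peanoIter α n w t :=
  (antitone_peanoIter hα hα1 hw ht).le_of_tendsto (tendsto_peanoIter hα hα1 hw ht) n

theorem abs_maxSolution_le (hα : 0 ≤ α) (hα1 : α ≤ 1) (hw : Continuous w) {t : ℝ}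
    (ht : 0 ≤ t) : |maxSolution α w t| ≤ peanoIter α 0 w t :=
  le_of_tendsto (tendsto_peanoIter hα hα1 hw ht).abs
    (Eventually.of_forall fun n => abs_peanoIter_le hα hα1 hw n t ht)

theorem intervalIntegrable_maxSolution (hα : 0 ≤ α) (hα1 : α ≤ 1) (hw : Continuous w)
    {t : ℝ} (ht : 0 ≤ t) :
    IntervalIntegrable (fun s => upperPeanoDrift α (maxSolution α w s) + w s) volume 0 t :=
  intervalIntegrable_upperPeanoDrift_add hα hα1 hw
    ((isCausal_maxSolution hα).measurable_apply hw.measurable)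
    (fun _ hs => abs_maxSolution_le hα hα1 hw hs) ht

/-- The iterates decrease, so that right continuity of the drift is enough to pass to the limit. -/
theorem maxSolution_eq (hα : 0 ≤ α) (hα1 : α ≤ 1) (hw : Continuous w) {t : ℝ} (ht : 0 ≤ t) :
    maxSolution α w t = ∫ s in (0 : ℝ)..t, (upperPeanoDrift α (maxSolution α w s) + w s) := by
  have hU := continuous_peanoIter_zero (α := α) hw
  refine tendsto_nhds_unique ((tendsto_add_atTop_iff_nat 1).2 (tendsto_peanoIter hα hα1 hw ht)) ?_
  refine intervalIntegral.tendsto_integral_filter_of_dominated_convergence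
    (fun s => 1 + peanoIter α 0 w s + |w s|) (Eventually.of_forall fun n => ?_)
    (Eventually.of_forall fun n => Eventually.of_forall fun s hs => ?_)
    (Continuous.intervalIntegrable (by fun_prop) _ _) (Eventually.of_forall fun s hs => ?_)
  · rw [Set.uIoc_of_le ht]
    exact (intervalIntegrable_peanoIter hα hα1 hw n ht).1.aestronglyMeasurable
  · rw [Set.uIoc_of_le ht] at hs
    rw [Real.norm_eq_abs]
    linarith [abs_add_le (upperPeanoDrift α (peanoIter α n w s)) (w s),
      abs_upperPeanoDrift_le hα hα1 (peanoIter α n w s), abs_peanoIter_le hα hα1 hw n s hs.1.le]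
  · rw [Set.uIoc_of_le ht] at hs
    refine Tendsto.add_const _ ?_
    refine (continuousWithinAt_upperPeanoDrift hα _).tendsto.comp ?_
    exact tendsto_nhdsWithin_iff.2 ⟨tendsto_peanoIter hα hα1 hw hs.1.le,
      Eventually.of_forall fun n => maxSolution_le_peanoIter hα hα1 hw hs.1.le n⟩

end MonotoneIteration

/-! ### The monotone limit leaves zero -/

/-- If `|w|` is integrable at `0` against `s ^ (-β)`, then its primitive is `o(t ^ β)`. -/
theorem exists_abs_integral_le_rpow {w : ℝ → ℝ} {β : ℝ} (hβ : 0 < β)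
    (hint : IntegrableOn (fun s => s ^ (-β) * |w s|) (Set.Ioc 0 1)) {ε : ℝ} (hε : 0 < ε) :
    ∃ τ, 0 < τ ∧ τ ≤ 1 ∧ ∀ t ∈ Set.Icc 0 τ, |∫ s in (0 : ℝ)..t, w s| ≤ ε * t ^ β := by
  have hint' : IntegrableOn (fun s => s ^ (-β) * |w s|) (Set.Icc 0 1) :=
    by
    rwa [integrableOn_Icc_iff_integrableOn_Ioc]
  have hc := intervalIntegral.continuousOn_primitive_interval (μ := volume) (a := 0) (b := 1)
    (by rwa [Set.uIcc_of_le zero_le_one])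
  rw [Set.uIcc_of_le zero_le_one] at hc
  have h0 := hc 0 (Set.left_mem_Icc.2 zero_le_one)
  rw [ContinuousWithinAt, intervalIntegral.integral_same, Metric.tendsto_nhdsWithin_nhds] at h0
  obtain ⟨δ, hδ, h⟩ := h0 ε hε
  refine ⟨min 1 (δ / 2), by positivity, min_le_left _ _, fun t ht => ?_⟩
  have ht1 : t ≤ 1 := ht.2.trans (min_le_left _ _)
  have h1 := h (show t ∈ Set.Icc 0 1 from ⟨ht.1, ht1⟩) (by
    rw [Real.dist_eq, sub_zero, abs_of_nonneg ht.1]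
    linarith [ht.2.trans (min_le_right _ _)])
  rw [Real.dist_eq, sub_zero] at h1
  have h2 : IntervalIntegrable (fun s => s ^ (-β) * |w s|) volume 0 t := by
    rw [intervalIntegrable_iff_integrableOn_Ioc_of_le ht.1]
    exact hint.mono_set (Set.Ioc_subset_Ioc_right ht1)
  calc |∫ s in (0 : ℝ)..t, w s| ≤ ∫ s in (0 : ℝ)..t, t ^ β * (s ^ (-β) * |w s|) := by
        rw [← Real.norm_eq_abs]
        refine intervalIntegral.norm_integral_le_of_norm_le ht.1
          (Eventually.of_forall fun s hs => ?_) (h2.const_mul _)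
        rw [Real.norm_eq_abs, ← mul_assoc]
        refine le_mul_of_one_le_left (abs_nonneg _) ?_
        rw [Real.rpow_neg hs.1.le, ← div_eq_mul_inv, one_le_div (Real.rpow_pos_of_pos hs.1 _)]
        exact Real.rpow_le_rpow hs.1.le hs.2 hβ.le
    _ = t ^ β * ∫ s in (0 : ℝ)..t, s ^ (-β) * |w s| := intervalIntegral.integral_const_mul _ _
    _ ≤ t ^ β * ε := by
        exact mul_le_mul_of_nonneg_left ((le_abs_self _).trans h1.le) (Real.rpow_nonneg ht.1 _)
    _ = ε * t ^ β := mul_comm _ _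

/-- The function `c t ^ β` with `β = 1 / (1 - α)` and `c = (2 β) ^ (-β)` is a subsolution near `0`,
since its drift `(c t ^ β) ^ α` has primitive `2 c t ^ β` and the noise contributes `o(t ^ β)`. -/
theorem exists_rpow_le_peanoIter {α : ℝ} (hα : 0 ≤ α) (hα1 : α < 1) {w : ℝ → ℝ}
    (hw : Continuous w)
    (hint : IntegrableOn (fun s => s ^ (-(1 - α)⁻¹) * |w s|) (Set.Ioc 0 1)) :
    ∃ c τ, 0 < c ∧ 0 < τ ∧ ∀ n, ∀ t ∈ Set.Icc 0 τ, c * t ^ (1 - α)⁻¹ ≤ peanoIter α n w t := by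
  set β := (1 - α)⁻¹ with hβ
  have hβ1 : 1 ≤ β := (one_le_inv₀ (by linarith)).2 (by linarith)
  have hαβ : α * β + 1 = β := by
    rw [hβ]
    field_simp [(by linarith : (1 - α) ≠ 0)]
    ring
  set c := (2 * β) ^ (-β) with hc
  have hc0 : 0 < c := Real.rpow_pos_of_pos (by linarith) _
  have hc1 : c ≤ 1 := Real.rpow_le_one_of_one_le_of_nonpos (by linarith) (by linarith)
  have hcα : c ^ α = 2 * β * c := by
    rw [hc, ← Real.rpow_mul (by linarith), show -β * α = 1 + -β by linarith,
      Real.rpow_add (by linarith), Real.rpow_one]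
  obtain ⟨τ, hτ, hτ1, hI⟩ := exists_abs_integral_le_rpow (by linarith : 0 < β) hint hc0
  refine ⟨c, τ, hc0, hτ, fun n => ?_⟩
  induction n with
  | zero =>
    intro t ht
    have h1 : c * t ^ β ≤ t := by
      have h2 : t ^ β ≤ t ^ (1 : ℝ) :=
        Real.rpow_le_rpow_of_exponent_ge' ht.1 (ht.2.trans hτ1) zero_le_one hβ1
      rw [Real.rpow_one] at h2
      nlinarith [Real.rpow_nonneg ht.1 β]
    refine h1.trans ?_
    have h3 : t ≤ ∫ s in (0 : ℝ)..t, (1 + |w s|) := by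
      calc t = ∫ _ in (0 : ℝ)..t, (1 : ℝ) := by simp
        _ ≤ _ := intervalIntegral.integral_mono_on ht.1
          (Continuous.intervalIntegrable (by fun_prop) _ _)
          (Continuous.intervalIntegrable (by fun_prop) _ _)
          fun s _ => by linarith [abs_nonneg (w s)]
    exact h3.trans (le_mul_of_one_le_left (ht.1.trans h3) (Real.one_le_exp ht.1))
  | succ n ih =>
    intro t ht
    have hrp : IntervalIntegrable (fun s : ℝ => c ^ α * s ^ (α * β)) volume 0 t :=
      (intervalIntegral.intervalIntegrable_rpow' (by nlinarith)).const_mul _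
    have h1 : ∫ s in (0 : ℝ)..t, c ^ α * s ^ (α * β) = 2 * c * t ^ β := by
      rw [intervalIntegral.integral_const_mul, integral_rpow (Or.inl (by nlinarith)), hαβ,
        Real.zero_rpow (by linarith), sub_zero, hcα]
      field_simp
    have h2 : ∫ s in (0 : ℝ)..t, (c ^ α * s ^ (α * β) + w s) ≤ peanoIter α (n + 1) w t := by
      refine intervalIntegral.integral_mono_on ht.1 (hrp.add (hw.intervalIntegrable _ _))
        (intervalIntegrable_peanoIter hα hα1.le hw n ht.1) fun s hs => ?_
      have h3 := monotone_upperPeanoDrift hα (ih s ⟨hs.1, hs.2.trans ht.2⟩)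
      have h4 : 0 ≤ c * s ^ β := mul_nonneg hc0.le (Real.rpow_nonneg hs.1 _)
      rw [upperPeanoDrift, if_pos h4, Real.mul_rpow hc0.le (Real.rpow_nonneg hs.1 _),
        ← Real.rpow_mul hs.1, mul_comm β α] at h3
      linarith
    rw [intervalIntegral.integral_add hrp (hw.intervalIntegrable _ _), h1] at h2
    linarith [(abs_le.1 (hI t ht)).1]

theorem eventually_maxSolution_pos {α : ℝ} (hα : 0 ≤ α) (hα1 : α < 1) {w : ℝ → ℝ}
    (hw : Continuous w)
    (hint : IntegrableOn (fun s => s ^ (-(1 - α)⁻¹) * |w s|) (Set.Ioc 0 1)) :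
    ∀ᶠ t in 𝓝[>] (0 : ℝ), 0 < maxSolution α w t := by
  obtain ⟨c, τ, hc, hτ, h⟩ := exists_rpow_le_peanoIter hα hα1 hw hint
  filter_upwards [Ioc_mem_nhdsGT hτ] with t ht
  refine (mul_pos hc (Real.rpow_pos_of_pos ht.1 (1 - α)⁻¹)).trans_le ?_
  exact ge_of_tendsto' (tendsto_peanoIter hα hα1.le hw ht.1.le) fun n => h n t ⟨ht.1.le, ht.2⟩

/-- At almost every zero of an indefinite integral the integrand vanishes. -/
theorem ae_eq_zero_of_integral_eq_zero {g u : ℝ → ℝ} {T : ℝ} (hg : IntervalIntegrable g volume 0 T)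
    (hu : ∀ t ∈ Set.Icc 0 T, u t = ∫ s in (0 : ℝ)..t, g s) :
    ∀ᵐ s ∂(volume.restrict (Set.Ioo 0 T)), u s = 0 → g s = 0 := by
  rcases le_or_gt T 0 with hT | hT
  · simp [Set.Ioo_eq_empty (not_lt.2 hT)]
  have h1 := hg.ae_hasDerivAt_integral
  have h2 : {x | x ∈ {t | t ∈ Set.Ioo 0 T ∧ u t = 0} ∧
      𝓝[{t | t ∈ Set.Ioo 0 T ∧ u t = 0} ∩ Set.Ioi x] x = ⊥}.Countable :=
    countable_setOfPred_isolated_right_within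
  have h3 := h2.ae_notMem volume
  refine (ae_restrict_iff' measurableSet_Ioo).2 ?_
  filter_upwards [h1, h3] with s hs hn hsT h0
  by_contra hne
  refine hn ⟨⟨hsT, h0⟩, ?_⟩
  have hd := hs (by rw [Set.uIcc_of_le hT.le]; exact ⟨hsT.1.le, hsT.2.le⟩) 0
    (by rw [Set.uIcc_of_le hT.le]; exact ⟨le_rfl, hT.le⟩)
  have hd' : HasDerivAt u (g s) s := by
    refine hd.congr_of_eventuallyEq ?_
    filter_upwards [Ioo_mem_nhds hsT.1 hsT.2] with t ht using hu t ⟨ht.1.le, ht.2.le⟩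
  have h5 := hd'.eventually_ne (c := 0) hne
  rw [← Filter.empty_mem_iff_bot]
  filter_upwards [nhdsWithin_mono s (fun z hz => (ne_of_gt hz.2 : z ≠ s)) h5,
    self_mem_nhdsWithin] with z hz1 hz2 using hz1 hz2.1.2

theorem continuousOn_Ici_of_eq_integral {g u : ℝ → ℝ}
    (hg : ∀ t, 0 ≤ t → IntervalIntegrable g volume 0 t)
    (hu : ∀ t, 0 ≤ t → u t = ∫ s in (0 : ℝ)..t, g s) : ContinuousOn u (Set.Ici 0) := by
  intro t ht
  have ht' : (0 : ℝ) ≤ t + 1 := by linarith [Set.mem_Ici.1 ht]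
  have h := intervalIntegral.continuousOn_primitive_interval' (hg (t + 1) ht') Set.left_mem_uIcc
  rw [Set.uIcc_of_le ht'] at h
  have h1 : ContinuousOn u (Set.Icc 0 (t + 1)) := h.congr fun s hs => hu s hs.1
  refine (h1 t ⟨ht, by linarith⟩).mono_of_mem_nhdsWithin ?_
  rw [← Set.Ici_inter_Iic]
  exact inter_mem self_mem_nhdsWithin (mem_nhdsWithin_of_mem_nhds (Iic_mem_nhds (by linarith)))

/-- The continuous path `x` solves `x' = peanoDrift α x + w`, `x 0 = 0`, on `[0, ∞)`, and is
positive at all small positive times. -/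
structure IsPositivePathSolution (α : ℝ) (w x : ℝ → ℝ) : Prop where
  continuousOn : ContinuousOn x (Set.Ici 0)
  intervalIntegrable : ∀ t, 0 ≤ t →
    IntervalIntegrable (fun s => peanoDrift α (x s)) volume 0 t
  eq : ∀ t, 0 ≤ t → x t = (∫ s in (0 : ℝ)..t, peanoDrift α (x s)) + ∫ s in (0 : ℝ)..t, w s
  pos : ∀ᶠ t in 𝓝[>] (0 : ℝ), 0 < x t

/-- For `0 ≤ α < 1` the limit of the monotone iteration solves the Peano equation. The
drifts `upperPeanoDrift 0` and `peanoDrift 0` differ at the zeros of the solution; at almost all of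
them the derivative `1 + w` vanishes, which happens on a null set only. -/
theorem isPositivePathSolution_maxSolution {α : ℝ} (hα : 0 ≤ α) (hα1 : α < 1) {w : ℝ → ℝ}
    (hw : Continuous w)
    (hint : IntegrableOn (fun s => s ^ (-(1 - α)⁻¹) * |w s|) (Set.Ioc 0 1))
    (hne : ∀ᵐ s ∂(volume.restrict (Set.Ioi (0 : ℝ))), w s ≠ -1) :
    IsPositivePathSolution α w (maxSolution α w) := by
  have hI := fun t (ht : 0 ≤ t) => intervalIntegrable_maxSolution hα hα1.le hw ht
  have hE := fun t (ht : 0 ≤ t) => maxSolution_eq hα hα1.le hw ht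
  have hae : ∀ t, 0 ≤ t → ∀ᵐ s ∂(volume.restrict (Set.Ioc 0 t)),
      upperPeanoDrift α (maxSolution α w s) = peanoDrift α (maxSolution α w s) := by
    intro t ht
    rcases hα.eq_or_lt with rfl | hpos
    · have h1 := ae_eq_zero_of_integral_eq_zero (hI (t + 1) (by linarith)) (fun s hs => hE s hs.1)
      have h2 := ae_restrict_of_ae_restrict_of_subset
        (show Set.Ioc 0 t ⊆ Set.Ioo 0 (t + 1) from fun s hs => ⟨hs.1, by linarith [hs.2]⟩) h1
      have h3 := ae_restrict_of_ae_restrict_of_subset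
        (show Set.Ioc 0 t ⊆ Set.Ioi 0 from fun s hs => hs.1) hne
      filter_upwards [h2, h3] with s h4 h5
      refine upperPeanoDrift_of_ne_zero _ fun h0 => h5 ?_
      have h6 := h4 h0
      rw [h0, upperPeanoDrift, if_pos le_rfl, Real.rpow_zero] at h6
      linarith
    · exact Eventually.of_forall fun s => upperPeanoDrift_of_pos hpos _
  have hU : ∀ t, 0 ≤ t →
      IntervalIntegrable (fun s => upperPeanoDrift α (maxSolution α w s)) volume 0 t := by
    intro t ht
    simpa using (hI t ht).sub (hw.intervalIntegrable 0 t)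
  refine ⟨continuousOn_Ici_of_eq_integral hI hE, fun t ht => ?_, fun t ht => ?_,
    eventually_maxSolution_pos hα hα1 hw hint⟩
  · refine (hU t ht).congr_ae ?_
    rw [Set.uIoc_of_le ht]
    exact hae t ht
  · rw [hE t ht, intervalIntegral.integral_add (hU t ht) (hw.intervalIntegrable 0 t)]
    congr 1
    refine intervalIntegral.integral_congr_ae_restrict ?_
    rw [Set.uIoc_of_le ht]
    exact hae t ht

/-! ### Picard iteration with a singular Lipschitz constant -/

section Picard

variable {F : ℝ → ℝ → ℝ} {y : ℕ → ℝ → ℝ} {γ A D T : ℝ}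

/-- Integrability of the right-hand side along a bounded function, for a Lipschitz constant
`A s ^ (γ - 1)` that is integrable but possibly unbounded at `0`. -/
theorem intervalIntegrable_of_lipschitz_rpow (hγ : 0 < γ) (hT : 0 ≤ T)
    (hD : ∀ s ∈ Set.Ioc 0 T, |F s 0| ≤ D)
    (hA : ∀ s ∈ Set.Ioc 0 T, ∀ a b, |F s a - F s b| ≤ A * s ^ (γ - 1) * |a - b|)
    {u : ℝ → ℝ} (hu : Measurable fun s => F s (u s)) {K : ℝ} (hK : ∀ s ∈ Set.Ioc 0 T, |u s| ≤ K)
    (hA0 : 0 ≤ A) :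
    (∀ s ∈ Set.Ioc 0 T, |F s (u s)| ≤ D + A * K * s ^ (γ - 1)) ∧
    IntervalIntegrable (fun s => D + A * K * s ^ (γ - 1)) volume 0 T ∧
    IntervalIntegrable (fun s => F s (u s)) volume 0 T := by
  have h1 : ∀ s ∈ Set.Ioc 0 T, |F s (u s)| ≤ D + A * K * s ^ (γ - 1) := by
    intro s hs
    have h2 := hA s hs (u s) 0
    rw [sub_zero] at h2
    have h3 : A * s ^ (γ - 1) * |u s| ≤ A * s ^ (γ - 1) * K :=
      mul_le_mul_of_nonneg_left (hK s hs) (mul_nonneg hA0 (Real.rpow_nonneg hs.1.le _))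
    have h4 := abs_sub_abs_le_abs_sub (F s (u s)) (F s 0)
    linarith [hD s hs]
  have h2 : IntervalIntegrable (fun s : ℝ => D + A * K * s ^ (γ - 1)) volume 0 T :=
    intervalIntegrable_const.add
      ((intervalIntegral.intervalIntegrable_rpow' (by linarith)).const_mul _)
  refine ⟨h1, h2, h2.mono_fun' hu.aestronglyMeasurable ?_⟩
  rw [Set.uIoc_of_le hT]
  exact (ae_restrict_iff' measurableSet_Ioc).2 (Eventually.of_forall h1)

theorem exists_abs_picard_le (hγ : 0 < γ) (hT : 0 ≤ T) (hA0 : 0 ≤ A)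
    (hD : ∀ s ∈ Set.Ioc 0 T, |F s 0| ≤ D)
    (hA : ∀ s ∈ Set.Ioc 0 T, ∀ a b, |F s a - F s b| ≤ A * s ^ (γ - 1) * |a - b|)
    (hy0 : ∀ t, y 0 t = 0) (hy : ∀ n t, y (n + 1) t = ∫ s in (0 : ℝ)..t, F s (y n s))
    (hm : ∀ n, Measurable fun s => F s (y n s)) (n : ℕ) :
    ∃ K, ∀ t ∈ Set.Icc 0 T, |y n t| ≤ K := by
  induction n with
  | zero => exact ⟨0, fun t _ => by rw [hy0, abs_zero]⟩
  | succ n ih =>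
    obtain ⟨K, hK⟩ := ih
    obtain ⟨h1, h2, -⟩ := intervalIntegrable_of_lipschitz_rpow hγ hT hD hA (hm n)
      (fun s hs => hK s ⟨hs.1.le, hs.2⟩) hA0
    refine ⟨∫ s in (0 : ℝ)..T, |D + A * K * s ^ (γ - 1)|, fun t ht => ?_⟩
    have hsub : Set.uIcc 0 t ⊆ Set.uIcc 0 T := by
      rw [Set.uIcc_of_le ht.1, Set.uIcc_of_le hT]
      exact Set.Icc_subset_Icc_right ht.2
    rw [hy, ← Real.norm_eq_abs]
    refine (intervalIntegral.norm_integral_le_of_norm_le ht.1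
      (Eventually.of_forall fun s hs => ?_) (h2.mono_set hsub).abs).trans ?_
    · exact (h1 s ⟨hs.1, hs.2.trans ht.2⟩).trans (le_abs_self _)
    · exact intervalIntegral.integral_mono_interval le_rfl ht.1 ht.2
        (Eventually.of_forall fun s => abs_nonneg _) h2.abs

/-- Successive Picard iterates differ by the terms of an exponential series. -/
theorem abs_picard_succ_sub_le (hγ : 0 < γ) (hT : 0 ≤ T) (hA0 : 0 ≤ A)
    (hD : ∀ s ∈ Set.Ioc 0 T, |F s 0| ≤ D)
    (hA : ∀ s ∈ Set.Ioc 0 T, ∀ a b, |F s a - F s b| ≤ A * s ^ (γ - 1) * |a - b|)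
    (hy0 : ∀ t, y 0 t = 0) (hy : ∀ n t, y (n + 1) t = ∫ s in (0 : ℝ)..t, F s (y n s))
    (hm : ∀ n, Measurable fun s => F s (y n s)) (n : ℕ) :
    ∀ t ∈ Set.Icc 0 T, |y (n + 1) t - y n t| ≤ D * T * ((A / γ * t ^ γ) ^ n / n.factorial) := by
  have hint : ∀ n, ∀ t ∈ Set.Icc 0 T, IntervalIntegrable (fun s => F s (y n s)) volume 0 t := by
    intro n t ht
    obtain ⟨K, hK⟩ := exists_abs_picard_le hγ hT hA0 hD hA hy0 hy hm n
    refine (intervalIntegrable_of_lipschitz_rpow hγ hT hD hA (hm n)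
      (fun s hs => hK s ⟨hs.1.le, hs.2⟩) hA0).2.2.mono_set ?_
    rw [Set.uIcc_of_le ht.1, Set.uIcc_of_le hT]
    exact Set.Icc_subset_Icc_right ht.2
  induction n with
  | zero =>
    intro t ht
    rcases ht.1.eq_or_lt with rfl | ht0
    · rcases hT.eq_or_lt with rfl | hT0
      · simp [hy, hy0]
      · have hD0 : 0 ≤ D := (abs_nonneg _).trans (hD T ⟨hT0, le_rfl⟩)
        simp only [hy, hy0, intervalIntegral.integral_same, sub_zero, abs_zero]
        positivity
    have hD0 : 0 ≤ D := (abs_nonneg _).trans (hD t ⟨ht0, ht.2⟩)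
    rw [hy, hy0, sub_zero, ← Real.norm_eq_abs]
    have h1 := intervalIntegral.norm_integral_le_of_norm_le_const (a := 0) (b := t)
      (f := fun s => F s (y 0 s)) (C := D) fun s hs => by
        rw [Set.uIoc_of_le ht.1] at hs
        rw [hy0]
        exact hD s ⟨hs.1, hs.2.trans ht.2⟩
    rw [sub_zero, abs_of_nonneg ht.1] at h1
    simp only [pow_zero, Nat.factorial_zero, Nat.cast_one, div_one, mul_one]
    exact h1.trans (mul_le_mul_of_nonneg_left ht.2 hD0)
  | succ n ih =>
    intro t ht
    have hexp : -1 < γ - 1 + γ * n := by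
      have : 0 ≤ γ * n := by positivity
      linarith
    have hp : IntervalIntegrable (fun s : ℝ => D * T * (A * (A / γ) ^ n / n.factorial) *
        s ^ (γ - 1 + γ * n)) volume 0 t :=
      (intervalIntegral.intervalIntegrable_rpow' hexp).const_mul _
    have hval : ∫ s in (0 : ℝ)..t, D * T * (A * (A / γ) ^ n / n.factorial) * s ^ (γ - 1 + γ * n)
        = D * T * ((A / γ * t ^ γ) ^ (n + 1) / (n + 1).factorial) := by
      have h1 : γ - 1 + γ * n + 1 = γ * (n + 1 : ℕ) := by push_cast; ring
      rw [intervalIntegral.integral_const_mul, integral_rpow (Or.inl hexp), h1,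
        Real.zero_rpow (by positivity), sub_zero, Real.rpow_mul ht.1, Real.rpow_natCast, mul_pow,
        Nat.factorial_succ, pow_succ (A / γ)]
      push_cast
      have : (n.factorial : ℝ) ≠ 0 := by positivity
      field_simp
    rw [← hval, hy (n + 1), hy n, ← intervalIntegral.integral_sub (hint _ t ht) (hint _ t ht),
      ← Real.norm_eq_abs]
    refine intervalIntegral.norm_integral_le_of_norm_le ht.1
      (Eventually.of_forall fun s hs => ?_) hp
    have hs' : s ∈ Set.Ioc 0 T := ⟨hs.1, hs.2.trans ht.2⟩
    have h2 := ih s ⟨hs.1.le, hs'.2⟩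
    have h3 : 0 ≤ A * s ^ (γ - 1) := mul_nonneg hA0 (Real.rpow_nonneg hs.1.le _)
    refine (hA s hs' _ _).trans ((mul_le_mul_of_nonneg_left h2 h3).trans_eq ?_)
    rw [Real.rpow_add hs.1, Real.rpow_mul hs.1.le, Real.rpow_natCast, mul_pow]
    ring

/-- Picard iteration for a right-hand side with Lipschitz constant `A s ^ (γ - 1)`. -/
theorem tendsto_picard (hγ : 0 < γ) (hT : 0 ≤ T) (hA0 : 0 ≤ A)
    (hD : ∀ s ∈ Set.Ioc 0 T, |F s 0| ≤ D)
    (hA : ∀ s ∈ Set.Ioc 0 T, ∀ a b, |F s a - F s b| ≤ A * s ^ (γ - 1) * |a - b|)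
    (hy0 : ∀ t, y 0 t = 0) (hy : ∀ n t, y (n + 1) t = ∫ s in (0 : ℝ)..t, F s (y n s))
    (hm : ∀ n, Measurable fun s => F s (y n s)) {Y : ℝ → ℝ}
    (hY : ∀ t, Y t = limsup (fun n => y n t) atTop) (hYm : Measurable fun s => F s (Y s)) :
    IntervalIntegrable (fun s => F s (Y s)) volume 0 T ∧
      Y T = ∫ s in (0 : ℝ)..T, F s (Y s) := by
  rcases hT.eq_or_lt with rfl | hT0
  · refine ⟨IntervalIntegrable.refl, ?_⟩
    have : ∀ n, y n 0 = 0 := by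
      rintro (_ | n)
      · exact hy0 0
      · rw [hy, intervalIntegral.integral_same]
    rw [hY, intervalIntegral.integral_same]
    simp [this]
  have hD0 : 0 ≤ D := (abs_nonneg _).trans (hD T ⟨hT0, le_rfl⟩)
  let d : ℕ → ℝ := fun n => D * T * ((A / γ * T ^ γ) ^ n / n.factorial)
  have hd0 : ∀ n, 0 ≤ d n := fun n => by positivity
  have hds : Summable d := (Real.summable_pow_div_factorial _).mul_left _
  have hdist : ∀ n, ∀ t ∈ Set.Icc 0 T, dist (y n t) (y (n + 1) t) ≤ d n := by
    intro n t ht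
    rw [dist_comm, Real.dist_eq]
    refine (abs_picard_succ_sub_le hγ hT hA0 hD hA hy0 hy hm n t ht).trans ?_
    have h1 : t ^ γ ≤ T ^ γ := Real.rpow_le_rpow ht.1 ht.2 hγ.le
    have h2 : 0 ≤ t ^ γ := Real.rpow_nonneg ht.1 _
    simp only [d]
    gcongr
  have hlim : ∀ t ∈ Set.Icc 0 T, Tendsto (fun n => y n t) atTop (𝓝 (Y t)) := by
    intro t ht
    obtain ⟨l, hl⟩ := cauchySeq_tendsto_of_complete
      (cauchySeq_of_dist_le_of_summable d (fun n => hdist n t ht) hds)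
    rw [hY, hl.limsup_eq]
    exact hl
  have hbound : ∀ n, ∀ t ∈ Set.Icc 0 T, |y n t| ≤ ∑' i, d i := by
    intro n t ht
    have h1 := dist_le_range_sum_of_dist_le (f := fun n => y n t) n (d := d)
      (fun {k} _ => hdist k t ht)
    rw [dist_comm, Real.dist_eq, hy0, sub_zero] at h1
    exact h1.trans (hds.sum_le_tsum _ fun i _ => hd0 i)
  have hYb : ∀ t ∈ Set.Icc 0 T, |Y t| ≤ ∑' i, d i := fun t ht =>
    le_of_tendsto (hlim t ht).abs (Eventually.of_forall fun n => hbound n t ht)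
  obtain ⟨-, hdom, hYi⟩ := intervalIntegrable_of_lipschitz_rpow hγ hT hD hA hYm
    (fun s hs => hYb s ⟨hs.1.le, hs.2⟩) hA0
  refine ⟨hYi, tendsto_nhds_unique
    ((tendsto_add_atTop_iff_nat 1).2 (hlim T ⟨hT, le_rfl⟩)) ?_⟩
  simp_rw [hy]
  refine intervalIntegral.tendsto_integral_filter_of_dominated_convergence _
    (Eventually.of_forall fun n => (hm n).aestronglyMeasurable)
    (Eventually.of_forall fun n => Eventually.of_forall fun s hs => ?_) hdom
    (Eventually.of_forall fun s hs => ?_)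
  · rw [Set.uIoc_of_le hT] at hs
    exact (intervalIntegrable_of_lipschitz_rpow hγ hT hD hA (hm n)
      (fun s hs => hbound n s ⟨hs.1.le, hs.2⟩) hA0).1 s hs
  · rw [Set.uIoc_of_le hT] at hs
    rw [tendsto_iff_dist_tendsto_zero]
    have h1 : Tendsto (fun n => A * s ^ (γ - 1) * |y n s - Y s|) atTop (𝓝 0) := by
      have h2 := (tendsto_iff_dist_tendsto_zero.1 (hlim s ⟨hs.1.le, hs.2⟩)).const_mul
        (A * s ^ (γ - 1))
      simpa [Real.dist_eq] using h2
    exact squeeze_zero (fun _ => dist_nonneg) (fun n => hA s hs _ _) h1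

end Picard

/-! ### Negative exponents -/

/-- `1 + sup_{0 ≤ s ≤ t} |w s|`, with the supremum taken over a countable set of times. -/
noncomputable def runningMax (w : ℝ → ℝ) (t : ℝ) : ℝ :=
  1 + ⨆ q : ℚ, |w (max 0 (min 1 (q : ℝ)) * t)|

theorem isCausal_runningMax : IsCausal runningMax where
  measurable Ω m Z hZ := by
    refine Measurable.const_add (Measurable.iSup fun q => ?_) 1
    have h : Measurable fun p : Ω × ℝ => (p.1, max 0 (min 1 (q : ℝ)) * p.2) := by fun_prop
    exact measurable_abs.comp (hZ.comp h)
  congr w w' t ht h := by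
    unfold runningMax
    congr 2
    ext q
    rw [h]
    have h1 : max 0 (min 1 (q : ℝ)) ≤ 1 := max_le zero_le_one (min_le_left _ _)
    exact ⟨mul_nonneg (le_max_left _ _) ht, mul_le_of_le_one_left ht h1⟩

section RunningMax

variable {w : ℝ → ℝ}

theorem bddAbove_runningMax (hw : Continuous w) (t : ℝ) :
    BddAbove (Set.range fun q : ℚ => |w (max 0 (min 1 (q : ℝ)) * t)|) := by
  have hc : Continuous fun r => |w (r * t)| := by fun_prop
  refine ((isCompact_Icc (a := (0 : ℝ)) (b := 1)).image hc).bddAbove.mono ?_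
  rintro _ ⟨q, rfl⟩
  exact ⟨_, ⟨le_max_left _ _, max_le zero_le_one (min_le_left _ _)⟩, rfl⟩

theorem abs_add_one_le_runningMax (hw : Continuous w) {s t : ℝ} (hs : s ∈ Set.Icc 0 t) :
    1 + |w s| ≤ runningMax w t := by
  rcases (hs.1.trans hs.2).eq_or_lt with rfl | ht
  · have hs0 : s = 0 := le_antisymm hs.2 hs.1
    have := le_ciSup (bddAbove_runningMax hw 0) 0
    simp only [mul_zero] at this
    rw [hs0]
    unfold runningMax
    simp only [mul_zero]
    linarith
  have key : ∀ r : ℝ, |w (max 0 (min 1 r) * t)| ≤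
      ⨆ q : ℚ, |w (max 0 (min 1 (q : ℝ)) * t)| := by
    intro r
    refine (Rat.denseRange_cast (𝕜 := ℝ)).induction_on (p := fun r : ℝ => |w (max 0 (min 1 r) * t)| ≤
      ⨆ q : ℚ, |w (max 0 (min 1 (q : ℝ)) * t)|) r ?_ ?_
    · exact isClosed_le (by fun_prop) continuous_const
    · exact fun q => le_ciSup (bddAbove_runningMax hw t) q
  have h1 := key (s / t)
  rw [min_eq_right (div_le_one_of_le₀ hs.2 ht.le), max_eq_right (div_nonneg hs.1 ht.le),
    div_mul_cancel₀ _ ht.ne'] at h1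
  unfold runningMax
  linarith

theorem runningMax_mono (hw : Continuous w) {s t : ℝ} (hs : s ∈ Set.Icc 0 t) :
    runningMax w s ≤ runningMax w t := by
  have h : ⨆ q : ℚ, |w (max 0 (min 1 (q : ℝ)) * s)| ≤ runningMax w t - 1 := by
    refine ciSup_le fun q => ?_
    have h1 : max 0 (min 1 (q : ℝ)) ≤ 1 := max_le zero_le_one (min_le_left _ _)
    have := abs_add_one_le_runningMax hw (s := max 0 (min 1 (q : ℝ)) * s) (t := t)
      ⟨mul_nonneg (le_max_left _ _) hs.1, (mul_le_of_le_one_left hs.1 h1).trans hs.2⟩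
    linarith
  unfold runningMax at h ⊢
  linarith

theorem one_le_runningMax (hw : Continuous w) {t : ℝ} (ht : 0 ≤ t) : 1 ≤ runningMax w t := by
  have := abs_add_one_le_runningMax hw (s := t) ⟨ht, le_rfl⟩
  linarith [abs_nonneg (w t)]

end RunningMax

/-- For `v > 0` the power function of exponent `γ ∈ (0, 1]` is Lipschitz on `[v, ∞)`. -/
theorem abs_rpow_sub_rpow_le {γ v p q : ℝ} (hγ : 0 < γ) (hγ1 : γ ≤ 1) (hv : 0 < v) (hp : v ≤ p)
    (hq : v ≤ q) : |p ^ γ - q ^ γ| ≤ v ^ (γ - 1) * |p - q| := by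
  wlog hpq : q ≤ p generalizing p q
  · rw [abs_sub_comm, abs_sub_comm p]
    exact this hq hp (le_of_not_ge hpq)
  have hq0 : 0 < q := hv.trans_le hq
  rw [abs_of_nonneg (sub_nonneg.2 (Real.rpow_le_rpow hq0.le hpq hγ.le)),
    abs_of_nonneg (sub_nonneg.2 hpq)]
  have h1 : (p / q) ^ γ ≤ p / q := by
    have := Real.rpow_le_rpow_of_exponent_le ((one_le_div hq0).2 hpq) hγ1
    rwa [Real.rpow_one] at this
  calc p ^ γ - q ^ γ = q ^ γ * ((p / q) ^ γ - 1) := by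
        rw [Real.div_rpow (hv.le.trans hp) hq0.le]
        have := (Real.rpow_pos_of_pos hq0 γ).ne'
        field_simp
    _ ≤ q ^ γ * (p / q - 1) := by
        have := (Real.rpow_pos_of_pos hq0 γ).le
        gcongr
    _ = q ^ (γ - 1) * (p - q) := by
        rw [Real.rpow_sub_one hq0.ne']
        field_simp
    _ ≤ v ^ (γ - 1) * (p - q) := by
        refine mul_le_mul_of_nonneg_right ?_ (sub_nonneg.2 hpq)
        exact Real.rpow_le_rpow_of_nonpos hv hq (by linarith)

/-- The exponent `γ = -α / (1 - α)` in the equation `y' = (1 - α) (1 + y ^ γ w)` that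
`y = x ^ (1 - α)` satisfies when `x' = x ^ α + w`. -/
noncomputable def powExponent (α : ℝ) : ℝ := -α / (1 - α)

/-- A lower barrier for `y' = (1 - α) (1 + y ^ γ w)`: below it, `y' ≥ (1 - α) / 2`. -/
noncomputable def powBarrier (α : ℝ) (w : ℝ → ℝ) (t : ℝ) : ℝ :=
  min ((1 - α) / 2 * t) ((2 * runningMax w t) ^ (-(powExponent α)⁻¹))

/-- The right-hand side of `y' = (1 - α) (1 + y ^ γ w)`, truncated below the barrier. -/
noncomputable def powDrift (α : ℝ) (w : ℝ → ℝ) (t y : ℝ) : ℝ :=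
  (1 - α) * (1 + max y (powBarrier α w t) ^ powExponent α * w t)

/-- Picard iteration for the truncated equation. -/
noncomputable def powIter (α : ℝ) : ℕ → (ℝ → ℝ) → ℝ → ℝ
  | 0, _, _ => 0
  | n + 1, w, t => ∫ s in (0 : ℝ)..t, powDrift α w s (powIter α n w s)

/-- The limit of the Picard iteration for the truncated equation. -/
noncomputable def powSolution (α : ℝ) (w : ℝ → ℝ) (t : ℝ) : ℝ :=
  limsup (fun n => powIter α n w t) atTop

theorem isCausal_powBarrier (α : ℝ) : IsCausal (powBarrier α) :=
  (IsCausal.time (g := fun t => (1 - α) / 2 * t) (by fun_prop)).map₂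
    (F := fun x y => min x y) (by fun_prop)
    (isCausal_runningMax.map (f := fun x => (2 * x) ^ (-(powExponent α)⁻¹))
      ((measurable_id.const_mul 2).pow_const _))

theorem IsCausal.powDrift {Ψ : (ℝ → ℝ) → ℝ → ℝ} (hΨ : IsCausal Ψ) (α : ℝ) :
    IsCausal fun w t => powDrift α w t (Ψ w t) := by
  have h1 := hΨ.map₂ (F := fun x y => max x y ^ powExponent α)
    ((measurable_fst.max measurable_snd).pow_const _) (isCausal_powBarrier α)
  exact h1.map₂ (F := fun x y => (1 - α) * (1 + x * y)) (by fun_prop) IsCausal.eval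

theorem isCausal_powIter (α : ℝ) (n : ℕ) : IsCausal (powIter α n) := by
  induction n with
  | zero => exact IsCausal.time measurable_const
  | succ n ih => exact (ih.powDrift α).integral

theorem isCausal_powSolution (α : ℝ) : IsCausal (powSolution α) :=
  IsCausal.limsup (isCausal_powIter α)

section PowEquation

variable {α : ℝ} {w : ℝ → ℝ}

theorem powExponent_pos (hα : α < 0) : 0 < powExponent α := div_pos (by linarith) (by linarith)

theorem powExponent_le_one (hα : α < 0) : powExponent α ≤ 1 :=
  (div_le_one (by linarith)).2 (by linarith)

theorem powBarrier_nonneg (hα : α < 0) (hw : Continuous w) {t : ℝ} (ht : 0 ≤ t) :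
    0 ≤ powBarrier α w t :=
  le_min (mul_nonneg (by linarith) ht)
    (Real.rpow_nonneg (by linarith [one_le_runningMax hw ht]) _)

theorem powBarrier_rpow_mul_le (hα : α < 0) (hw : Continuous w) {t : ℝ} (ht : 0 ≤ t) :
    powBarrier α w t ^ powExponent α * |w t| ≤ 1 / 2 := by
  have hM := one_le_runningMax hw ht
  have hγ := powExponent_pos hα
  have h1 : powBarrier α w t ^ powExponent α ≤ (2 * runningMax w t)⁻¹ := by
    refine (Real.rpow_le_rpow (powBarrier_nonneg hα hw ht) (min_le_right _ _) hγ.le).trans_eq ?_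
    rw [← Real.rpow_mul (by linarith), neg_mul, inv_mul_cancel₀ hγ.ne', Real.rpow_neg_one]
  have h2 : |w t| ≤ runningMax w t := by
    linarith [abs_add_one_le_runningMax hw (s := t) ⟨ht, le_rfl⟩]
  calc _ ≤ (2 * runningMax w t)⁻¹ * runningMax w t := by gcongr
    _ = 1 / 2 := by field_simp

theorem min_le_powBarrier (hα : α < 0) (hw : Continuous w) {s T : ℝ} (hs : s ∈ Set.Icc 0 T) :
    min ((1 - α) / 2 * s) ((2 * runningMax w T) ^ (-(powExponent α)⁻¹)) ≤ powBarrier α w s := by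
  refine min_le_min le_rfl ?_
  have hγ := powExponent_pos hα
  refine Real.rpow_le_rpow_of_nonpos (by linarith [one_le_runningMax hw hs.1]) ?_
    (by linarith [inv_pos.2 hγ])
  linarith [runningMax_mono hw hs]

theorem exists_lipschitz_powDrift (hα : α < 0) (hw : Continuous w) {T : ℝ} (hT : 0 ≤ T) :
    ∃ A, 0 ≤ A ∧ ∀ s ∈ Set.Ioc 0 T, ∀ a b, |powDrift α w s a - powDrift α w s b| ≤
      A * s ^ (powExponent α - 1) * |a - b| := by
  have hγ := powExponent_pos hα
  have hγ1 := powExponent_le_one hα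
  set γ := powExponent α
  have hM := one_le_runningMax hw hT
  set M := runningMax w T
  -- on `[0, T]` the barrier lies above the line of slope `m`
  set m := min ((1 - α) / 2) ((2 * M) ^ (-γ⁻¹) / (T + 1)) with hm
  have hm0 : 0 < m := by
    have : 0 < (2 * M) ^ (-γ⁻¹) := Real.rpow_pos_of_pos (by linarith) _
    exact lt_min (by linarith) (by positivity)
  refine ⟨(1 - α) * M * m ^ (γ - 1), mul_nonneg (mul_nonneg (by linarith) (by linarith))
    (Real.rpow_nonneg hm0.le _), fun s hs a b => ?_⟩
  have hv : m * s ≤ powBarrier α w s := by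
    refine le_trans (le_min ?_ ?_) (min_le_powBarrier hα hw ⟨hs.1.le, hs.2⟩)
    · exact mul_le_mul_of_nonneg_right (min_le_left _ _) hs.1.le
    · have h1 : m * (T + 1) ≤ (2 * M) ^ (-γ⁻¹) := by
        rw [← le_div_iff₀ (by linarith)]
        exact min_le_right _ _
      refine le_trans ?_ h1
      gcongr
      linarith [hs.2]
  have hms : 0 < m * s := mul_pos hm0 hs.1
  have h1 := abs_rpow_sub_rpow_le hγ hγ1 hms (hv.trans (le_max_right a _))
    (hv.trans (le_max_right b _))
  have h2 : |max a (powBarrier α w s) - max b (powBarrier α w s)| ≤ |a - b| :=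
    abs_max_sub_max_le_abs _ _ _
  have h3 : |w s| ≤ M := by
    linarith [abs_add_one_le_runningMax hw (s := s) (t := T) ⟨hs.1.le, hs.2⟩]
  have h4 : powDrift α w s a - powDrift α w s b
      = (1 - α) * (w s * (max a (powBarrier α w s) ^ γ - max b (powBarrier α w s) ^ γ)) := by
    unfold powDrift
    ring
  have h5 : 0 ≤ (m * s) ^ (γ - 1) := Real.rpow_nonneg hms.le _
  rw [h4, abs_mul, abs_mul, abs_of_pos (by linarith : 0 < 1 - α)]
  calc _ ≤ (1 - α) * (M * ((m * s) ^ (γ - 1) * |a - b|)) := by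
        have := h1.trans (mul_le_mul_of_nonneg_left h2 h5)
        have h6 : 0 ≤ 1 - α := by linarith
        gcongr
    _ = _ := by
        rw [Real.mul_rpow hm0.le hs.1.le]
        ring

theorem powSolution_spec (hα : α < 0) (hw : Continuous w) {T : ℝ} (hT : 0 ≤ T) :
    IntervalIntegrable (fun s => powDrift α w s (powSolution α w s)) volume 0 T ∧
      powSolution α w T = ∫ s in (0 : ℝ)..T, powDrift α w s (powSolution α w s) := by
  obtain ⟨A, hA0, hA⟩ := exists_lipschitz_powDrift hα hw hT
  refine tendsto_picard (F := powDrift α w) (y := fun n => powIter α n w) (D := (1 - α) * (3 / 2))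
    (powExponent_pos hα) hT hA0 (fun s hs => ?_) hA (fun _ => rfl) (fun _ _ => rfl)
    (fun n => ((isCausal_powIter α n).powDrift α).measurable_apply hw.measurable) (fun _ => rfl)
    (((isCausal_powSolution α).powDrift α).measurable_apply hw.measurable)
  have h1 := powBarrier_rpow_mul_le hα hw hs.1.le
  have h0 := powBarrier_nonneg hα hw hs.1.le
  rw [powDrift, max_eq_right h0, abs_mul, abs_of_pos (by linarith : 0 < 1 - α)]
  refine mul_le_mul_of_nonneg_left ?_ (by linarith)
  refine (abs_add_le _ _).trans ?_
  rw [abs_one, abs_mul, abs_of_nonneg (Real.rpow_nonneg h0 _)]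
  linarith

theorem continuousOn_powSolution (hα : α < 0) (hw : Continuous w) :
    ContinuousOn (powSolution α w) (Set.Ici 0) :=
  continuousOn_Ici_of_eq_integral (fun _ ht => (powSolution_spec hα hw ht).1)
    (fun _ ht => (powSolution_spec hα hw ht).2)

/-- The solution of the truncated equation stays above the barrier: after its last visit above, it
would grow at least as fast as the barrier. Hence it solves the original equation. -/
theorem powBarrier_le_powSolution (hα : α < 0) (hw : Continuous w) {T : ℝ} (hT : 0 ≤ T) :
    powBarrier α w T ≤ powSolution α w T := by
  set Y := powSolution α w with hY
  set u : ℝ → ℝ := fun s => min ((1 - α) / 2 * s) ((2 * runningMax w T) ^ (-(powExponent α)⁻¹))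
    with hu
  have huc : Continuous u := by fun_prop
  by_contra! hlt
  have hlt' : Y T < u T := hlt
  have hYc : ContinuousOn Y (Set.Icc 0 T) :=
    (continuousOn_powSolution hα hw).mono Set.Icc_subset_Ici_self
  let S : Set ℝ := {r ∈ Set.Icc 0 T | u r ≤ Y r}
  have hSclosed : IsClosed S := isClosed_Icc.isClosed_le huc.continuousOn hYc
  have hS0 : (0 : ℝ) ∈ S := by
    refine ⟨⟨le_rfl, hT⟩, ?_⟩
    rw [hY, (powSolution_spec hα hw le_rfl).2, intervalIntegral.integral_same]
    simp [hu]
  have hSb : BddAbove S := ⟨T, fun r hr => hr.1.2⟩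
  obtain ⟨hsT, hsY⟩ := hSclosed.csSup_mem ⟨0, hS0⟩ hSb
  set s := sSup S with hs
  have hlow : ∀ r ∈ Set.Ioo s T, (1 - α) / 2 ≤ powDrift α w r (Y r) := by
    intro r hr
    have hr0 : 0 ≤ r := hsT.1.trans hr.1.le
    have h1 : Y r < u r := by
      by_contra! h
      exact (not_le.2 hr.1) (le_csSup hSb ⟨⟨hr0, hr.2.le⟩, h⟩)
    have h2 : u r ≤ powBarrier α w r := min_le_powBarrier hα hw ⟨hr0, hr.2.le⟩
    have h3 := powBarrier_rpow_mul_le hα hw hr0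
    have h4 := Real.rpow_nonneg (powBarrier_nonneg hα hw hr0) (powExponent α)
    rw [powDrift, max_eq_right (h1.le.trans h2)]
    have h5 : -(1 / 2) ≤ powBarrier α w r ^ powExponent α * w r := by
      nlinarith [neg_abs_le (w r)]
    nlinarith
  have hIT := powSolution_spec hα hw hT
  have hIs := powSolution_spec hα hw hsT.1
  have hsub : IntervalIntegrable (fun r => powDrift α w r (Y r)) volume s T := hIs.1.symm.trans hIT.1
  have h1 : Y T - Y s = ∫ r in s..T, powDrift α w r (Y r) := by
    rw [hY, hIT.2, hIs.2, intervalIntegral.integral_interval_sub_left hIT.1 hIs.1]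
  have h2 : (1 - α) / 2 * (T - s) ≤ ∫ r in s..T, powDrift α w r (Y r) := by
    have h3 := intervalIntegral.integral_mono_on_of_le_Ioo hsT.2
      (intervalIntegrable_const (c := (1 - α) / 2)) hsub hlow
    rw [intervalIntegral.integral_const, smul_eq_mul] at h3
    linarith
  have h3 : u T ≤ u s + (1 - α) / 2 * (T - s) := by
    simp only [hu]
    rw [← min_add_add_right]
    refine le_min ((min_le_left _ _).trans_eq (by ring)) ((min_le_right _ _).trans ?_)
    have : 0 ≤ (1 - α) / 2 * (T - s) := mul_nonneg (by linarith) (by linarith [hsT.2])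
    linarith
  linarith

theorem powSolution_pos (hα : α < 0) (hw : Continuous w) {t : ℝ} (ht : 0 < t) :
    0 < powSolution α w t := by
  refine lt_of_lt_of_le ?_ (powBarrier_le_powSolution hα hw ht.le)
  refine lt_min (mul_pos (by linarith) ht) (Real.rpow_pos_of_pos ?_ _)
  linarith [one_le_runningMax hw ht.le]

theorem hasDerivAt_powSolution (hα : α < 0) (hw : Continuous w) {t : ℝ} (ht : 0 < t) :
    HasDerivAt (powSolution α w)
      ((1 - α) * (1 + powSolution α w t ^ powExponent α * w t)) t := by
  have hYc := continuousOn_powSolution hα hw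
  set Y := powSolution α w with hY
  have hg : ∀ s, 0 ≤ s → powDrift α w s (Y s) = (1 - α) * (1 + Y s ^ powExponent α * w s) := by
    intro s hs
    rw [powDrift, max_eq_left (powBarrier_le_powSolution hα hw hs)]
  have hgc : ContinuousOn (fun s => powDrift α w s (Y s)) (Set.Ici 0) := by
    refine ContinuousOn.congr ?_ fun s hs => hg s hs
    have h1 : ContinuousOn (fun s => Y s ^ powExponent α) (Set.Ici 0) :=
      hYc.rpow_const fun _ _ => Or.inr (powExponent_pos hα).le
    exact continuousOn_const.mul (continuousOn_const.add (h1.mul hw.continuousOn))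
  have hnhds : Set.Ici 0 ∈ 𝓝 t := Ici_mem_nhds ht
  have hd := intervalIntegral.integral_hasDerivAt_right (powSolution_spec hα hw ht.le).1
    ((hgc.mono Set.Ioi_subset_Ici_self).stronglyMeasurableAtFilter isOpen_Ioi t ht)
    (hgc.continuousAt hnhds)
  rw [hg t ht.le] at hd
  refine hd.congr_of_eventuallyEq ?_
  filter_upwards [hnhds] with s hs using (powSolution_spec hα hw hs).2

/-- For `α < 0`, the power `1 / (1 - α)` of the solution of `y' = (1 - α) (1 + y ^ γ w)` solves the
Peano equation. -/
theorem isPositivePathSolution_powSolution (hα : α < 0) (hw : Continuous w) :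
    IsPositivePathSolution α w fun t => powSolution α w t ^ (1 - α)⁻¹ := by
  have hκ : 0 < 1 - α := by linarith
  set Y := powSolution α w with hY
  have hpos : ∀ t, 0 < t → 0 < Y t := fun t ht => powSolution_pos hα hw ht
  have hcont : ContinuousOn (fun t => Y t ^ (1 - α)⁻¹) (Set.Ici 0) :=
    (continuousOn_powSolution hα hw).rpow_const fun _ _ => Or.inr (inv_pos.2 hκ).le
  have hdrift : ∀ t, 0 < t → peanoDrift α (Y t ^ (1 - α)⁻¹) = Y t ^ ((1 - α)⁻¹ - 1) := by
    intro t ht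
    have h1 := Real.rpow_pos_of_pos (hpos t ht) (1 - α)⁻¹
    rw [peanoDrift, Real.sign_of_pos h1, one_mul, abs_of_pos h1, ← Real.rpow_mul (hpos t ht).le]
    congr 1
    field_simp
    ring
  have hderiv : ∀ t, 0 < t → HasDerivAt (fun t => Y t ^ (1 - α)⁻¹ - ∫ s in (0 : ℝ)..t, w s)
      (peanoDrift α (Y t ^ (1 - α)⁻¹)) t := by
    intro t ht
    have h1 := (hasDerivAt_powSolution hα hw ht).rpow_const (p := (1 - α)⁻¹)
      (Or.inl (hpos t ht).ne')
    have h2 := h1.sub (hw.integral_hasStrictDerivAt 0 t).hasDerivAt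
    refine h2.congr_deriv ?_
    have h3 : Y t ^ ((1 - α)⁻¹ - 1) * Y t ^ powExponent α = 1 := by
      rw [← Real.rpow_add (hpos t ht), powExponent]
      rw [show (1 - α)⁻¹ - 1 + -α / (1 - α) = 0 by field_simp; ring, Real.rpow_zero]
    rw [hdrift t ht]
    have h4 : (1 - α) * (1 - α)⁻¹ = 1 := mul_inv_cancel₀ hκ.ne'
    linear_combination (Y t ^ ((1 - α)⁻¹ - 1) * (1 + Y t ^ powExponent α * w t)) * h4 + w t * h3
  have hprim : Continuous fun t => ∫ s in (0 : ℝ)..t, w s :=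
    intervalIntegral.continuous_primitive (fun a b => hw.intervalIntegrable a b) 0
  have hnonneg : ∀ t, 0 < t → 0 ≤ peanoDrift α (Y t ^ (1 - α)⁻¹) := fun t ht => by
    rw [hdrift t ht]
    exact Real.rpow_nonneg (hpos t ht).le _
  have hint : ∀ t, 0 ≤ t →
      IntervalIntegrable (fun s => peanoDrift α (Y s ^ (1 - α)⁻¹)) volume 0 t := by
    intro t ht
    rw [intervalIntegrable_iff_integrableOn_Ioc_of_le ht]
    exact intervalIntegral.integrableOn_deriv_of_nonneg
      ((hcont.mono Set.Icc_subset_Ici_self).sub hprim.continuousOn)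
      (fun s hs => hderiv s hs.1) (fun s hs => hnonneg s hs.1)
  refine ⟨hcont, hint, fun t ht => ?_, ?_⟩
  · have h1 := intervalIntegral.integral_eq_sub_of_hasDerivAt_of_le ht
      ((hcont.mono Set.Icc_subset_Ici_self).sub hprim.continuousOn)
      (fun s hs => hderiv s hs.1) (hint t ht)
    have h0 : Y 0 = 0 := by
      rw [hY, (powSolution_spec hα hw le_rfl).2, intervalIntegral.integral_same]
    rw [h1]
    simp [h0, Real.zero_rpow (inv_pos.2 hκ).ne']
  · filter_upwards [self_mem_nhdsWithin] with t ht
    exact Real.rpow_pos_of_pos (hpos t ht) _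

end PowEquation

/-! ### Failure of uniqueness in law -/

theorem exists_isCausal_isPositivePathSolution {α : ℝ} (hα : α < 1) :
    ∃ Ψ, IsCausal Ψ ∧ ∀ w : ℝ → ℝ, Continuous w →
      IntegrableOn (fun s => s ^ (-(1 - α)⁻¹) * |w s|) (Set.Ioc 0 1) →
      (∀ᵐ s ∂(volume.restrict (Set.Ioi (0 : ℝ))), w s ≠ -1) →
      IsPositivePathSolution α w (Ψ w) := by
  rcases lt_or_ge α 0 with hneg | hnonneg
  · exact ⟨_, (isCausal_powSolution α).map (f := fun x => x ^ (1 - α)⁻¹)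
      (measurable_id.pow_const _), fun w hw _ _ => isPositivePathSolution_powSolution hneg hw⟩
  · exact ⟨_, isCausal_maxSolution hnonneg, fun w hw hint hne =>
      isPositivePathSolution_maxSolution hnonneg hα hw hint hne⟩

/-- A weak solution on `[0, ∞)`, hence on every time interval, that is positive at all small
positive times. -/
theorem exists_isWeakSolution_eventually_pos {α : ℝ} (hα : α < 1 / 3) :
    ∃ (Ω : Type) (mΩ : MeasurableSpace Ω) (P : Measure Ω) (ℱ : Filtration ℝ≥0 mΩ)
      (W X : ℝ≥0 → Ω → ℝ), (∀ T, IsWeakSolution α 0 T P ℱ W X) ∧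
        ∀ᵐ ω ∂P, ∀ᶠ t in 𝓝[>] (0 : ℝ), 0 < X t.toNNReal ω := by
  obtain ⟨Ω, mΩ, P, W, hWm, hWc, hW⟩ := exists_continuous_isPreBrownianReal
  obtain ⟨Ψ, hΨ, hsol⟩ := exists_isCausal_isPositivePathSolution (by linarith : α < 1)
  have hβ : (1 - α)⁻¹ < 3 / 2 := by
    rw [inv_lt_comm₀ (by linarith) (by norm_num)]
    linarith
  have hB : IsBrownianReal W P := ⟨hW, Eventually.of_forall hWc⟩
  have hF := hB.isFilteredBrownian_natural fun t => (hWm t).stronglyMeasurable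
  let w : Ω → ℝ → ℝ := fun ω s => W s.toNNReal ω
  have hw : ∀ ω, Continuous (w ω) := fun ω => (hWc ω).comp continuous_real_toNNReal
  have hgood : ∀ᵐ ω ∂P, IsPositivePathSolution α (w ω) (Ψ (w ω)) := by
    filter_upwards [hW.ae_integrableOn_rpow_mul hWm hWc hβ, hW.ae_ae_ne hWm hWc (-1)] with ω h1 h2
    exact hsol (w ω) (hw ω) h1 h2
  have hcoe : ∀ ω, ∀ t : ℝ≥0, Set.EqOn (fun s : ℝ => peanoDrift α (Ψ (w ω) s.toNNReal))
      (fun s => peanoDrift α (Ψ (w ω) s)) (Set.uIcc 0 t) := by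
    intro ω t s hs
    rw [Set.uIcc_of_le (NNReal.coe_nonneg t)] at hs
    simp only [Real.coe_toNNReal s hs.1]
  refine ⟨Ω, mΩ, P, Filtration.natural W fun t => (hWm t).stronglyMeasurable, W,
    fun t ω => Ψ (w ω) t, fun T => ?_, ?_⟩
  · refine ⟨hW.isGaussianProcess.isProbabilityMeasure, hF, hΨ.adapted hF.adapted hWc, ?_, ?_, ?_⟩
    · filter_upwards [hgood] with ω hω
      exact hω.continuousOn.comp_continuous NNReal.continuous_coe fun t => t.2
    · filter_upwards [hgood] with ω hω t _
      refine (hω.intervalIntegrable t t.2).congr fun s hs => ?_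
      exact (hcoe ω t (Set.uIoc_subset_uIcc hs)).symm
    · filter_upwards [hgood] with ω hω t _
      rw [hω.eq t t.2, zero_add]
      congr 1
      exact (intervalIntegral.integral_congr (hcoe ω t)).symm
  · filter_upwards [hgood] with ω hω
    filter_upwards [hω.pos, self_mem_nhdsWithin] with t ht ht0
    rwa [Real.coe_toNNReal t (le_of_lt ht0)]

theorem peanoDrift_neg (α x : ℝ) : peanoDrift α (-x) = -peanoDrift α x := by
  simp [peanoDrift, Real.sign_neg]

/-- The equation started at `0` is invariant under `(W, X) ↦ (-W, -X)`, the drift being odd. -/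
theorem IsWeakSolution.neg {Ω : Type*} {mΩ : MeasurableSpace Ω} {α : ℝ} {T : ℝ≥0∞}
    {P : Measure Ω} {ℱ : Filtration ℝ≥0 mΩ} {W X : ℝ≥0 → Ω → ℝ}
    (h : IsWeakSolution α 0 T P ℱ W X) : IsWeakSolution α 0 T P ℱ (-W) (-X) where
  isProbabilityMeasure := h.isProbabilityMeasure
  isFilteredBrownian := h.isFilteredBrownian.neg
  adapted t := (h.adapted t).neg
  continuous := by
    filter_upwards [h.continuous] with ω hω using hω.neg
  drift_integrable := by
    filter_upwards [h.drift_integrable] with ω hω t ht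
    simp only [Pi.neg_apply, peanoDrift_neg]
    exact (hω t ht).neg
  equation := by
    filter_upwards [h.equation] with ω hω t ht
    simp only [timeIntegral, Pi.neg_apply, peanoDrift_neg, intervalIntegral.integral_neg]
    rw [hω t ht, timeIntegral, timeIntegral]
    ring

theorem not_weakUniqueness {α : ℝ} (hα : α < 1 / 3) {T : ℝ≥0∞} (hT : 0 < T) :
    ¬ WeakUniqueness α 0 T := by
  intro hU
  obtain ⟨Ω, mΩ, P, ℱ, W, X, hX, hpos⟩ := exists_isWeakSolution_eventually_pos hα
  have hP := (hX T).isProbabilityMeasure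
  have hlaw := hU Ω Ω mΩ mΩ P P ℱ ℱ W X (-W) (-X) (hX T) (hX T).neg
  -- a sequence of positive times in `[0, T]` decreasing to `0`
  obtain ⟨r, hr0, hrT⟩ : ∃ r : ℝ≥0, 0 < r ∧ (r : ℝ≥0∞) ≤ T := by
    obtain ⟨r, h1, h2⟩ := ENNReal.lt_iff_exists_nnreal_btwn.1 hT
    exact ⟨r, by exact_mod_cast h1, h2.le⟩
  let τ : ℕ → {t : ℝ≥0 // (t : ℝ≥0∞) ≤ T} := fun n =>
    ⟨r / (n + 1), le_trans (by exact_mod_cast div_le_self zero_le (by simp)) hrT⟩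
  have hτ : Tendsto (fun n => ((τ n : ℝ≥0) : ℝ)) atTop (𝓝[>] 0) := by
    refine tendsto_nhdsWithin_iff.2 ⟨?_, Eventually.of_forall fun n => ?_⟩
    · have := (tendsto_add_atTop_iff_nat 1).2 (tendsto_const_div_atTop_nhds_zero_nat (r : ℝ))
      simpa [τ] using this
    · have : (0 : ℝ≥0) < r / (n + 1) := by positivity
      exact NNReal.coe_pos.2 this
  let A : Set ({t : ℝ≥0 // (t : ℝ≥0∞) ≤ T} → ℝ) := {x | ∀ᶠ n in atTop, 0 < x (τ n)}
  have hA : MeasurableSet A := by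
    have : A = ⋃ N : ℕ, ⋂ n ≥ N, {x | 0 < x (τ n)} := by
      ext x
      simp [A, eventually_atTop]
    rw [this]
    exact MeasurableSet.iUnion fun N => MeasurableSet.iInter fun n => MeasurableSet.iInter fun _ =>
      measurableSet_lt measurable_const (measurable_pi_apply _)
  have hmeas : ∀ Y : ℝ≥0 → Ω → ℝ, Adapted ℱ Y →
      Measurable fun ω (t : {t : ℝ≥0 // (t : ℝ≥0∞) ≤ T}) => Y t ω := fun Y hY =>
    measurable_pi_lambda _ fun t => hY.measurable
  have hXA : ∀ᵐ ω ∂P, (fun t : {t : ℝ≥0 // (t : ℝ≥0∞) ≤ T} => X t ω) ∈ A := by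
    filter_upwards [hpos] with ω hω
    have h := hτ.eventually hω
    simp only [Real.toNNReal_coe] at h
    exact h
  have hnegA : ∀ᵐ ω ∂P, (fun t : {t : ℝ≥0 // (t : ℝ≥0∞) ≤ T} => (-X) t ω) ∈ A := by
    have h1 : ∀ᵐ x ∂(pathLaw T P X), x ∈ A :=
      (ae_map_iff (hmeas X (hX T).adapted).aemeasurable hA).2 hXA
    rw [hlaw] at h1
    exact (ae_map_iff (hmeas (-X) (hX T).neg.adapted).aemeasurable hA).1 h1
  obtain ⟨ω, h1, h2⟩ := (hXA.and hnegA).exists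
  obtain ⟨n, h3, h4⟩ := (Eventually.and h1 h2).exists
  simp only [Pi.neg_apply] at h4
  linarith

theorem abs_peanoDrift_sub_le {α : ℝ} (hα : 0 < α) (hα1 : α ≤ 1) (x y : ℝ) :
    |peanoDrift α x - peanoDrift α y| ≤ 2 * |x - y| ^ α := by
  have hpos : ∀ z : ℝ, 0 ≤ z → peanoDrift α z = z ^ α := by
    intro z hz
    rcases hz.eq_or_lt with rfl | hz
    · simp [peanoDrift, Real.zero_rpow hα.ne']
    · rw [peanoDrift, Real.sign_of_pos hz, abs_of_pos hz, one_mul]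
  -- two arguments of the same sign: subadditivity of the power function
  have hsame : ∀ a b : ℝ, 0 ≤ b → b ≤ a → |a ^ α - b ^ α| ≤ (a - b) ^ α := by
    intro a b hb hab
    rw [abs_of_nonneg (sub_nonneg.2 (Real.rpow_le_rpow hb hab hα.le))]
    have := Real.rpow_add_le_add_rpow (sub_nonneg.2 hab) hb hα.le hα1
    rw [sub_add_cancel] at this
    linarith
  wlog hxy : y ≤ x generalizing x y
  · rw [abs_sub_comm, abs_sub_comm x]
    exact this y x (le_of_not_ge hxy)
  rw [abs_of_nonneg (sub_nonneg.2 hxy)]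
  have hnn : 0 ≤ (x - y) ^ α := Real.rpow_nonneg (by linarith) _
  rcases le_total 0 y with hy | hy
  · rw [hpos x (hy.trans hxy), hpos y hy]
    linarith [hsame x y hy hxy]
  · have hy' : peanoDrift α y = -(-y) ^ α := by
      rw [← hpos (-y) (by linarith), peanoDrift_neg, neg_neg]
    rcases le_total 0 x with hx | hx
    · rw [hpos x hx, hy', sub_neg_eq_add,
        abs_of_nonneg (add_nonneg (Real.rpow_nonneg hx _) (Real.rpow_nonneg (by linarith) _))]
      have h1 : x ^ α ≤ (x - y) ^ α := Real.rpow_le_rpow hx (by linarith) hα.le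
      have h2 : (-y) ^ α ≤ (x - y) ^ α := Real.rpow_le_rpow (by linarith) (by linarith) hα.le
      linarith
    · have hx' : peanoDrift α x = -(-x) ^ α := by
        rw [← hpos (-x) (by linarith), peanoDrift_neg, neg_neg]
      have h1 := hsame (-y) (-x) (by linarith) (by linarith)
      rw [hx', hy', show -(-x) ^ α - -(-y) ^ α = (-y) ^ α - (-x) ^ α by ring]
      rw [show -y - -x = x - y by ring] at h1
      linarith

theorem holderWith_peanoDrift {α : ℝ} (hα : 0 < α) (hα1 : α ≤ 1) :
    HolderWith 2 α.toNNReal (peanoDrift α) := by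
  intro x y
  rw [edist_dist, edist_dist, Real.coe_toNNReal _ hα.le,
    ENNReal.ofReal_rpow_of_nonneg dist_nonneg hα.le, ← ENNReal.ofReal_coe_nnreal,
    ← ENNReal.ofReal_mul (NNReal.coe_nonneg 2)]
  refine ENNReal.ofReal_le_ofReal ?_
  rw [Real.dist_eq, Real.dist_eq]
  exact abs_peanoDrift_sub_le hα hα1 x y

theorem mainTheorem4 (α : ℝ) (hα : α < 1 / 3) :
    (∀ T : ℝ≥0∞, 0 < T → ¬ WeakUniqueness α 0 T) ∧
      (0 < α → ∃ C : ℝ≥0, HolderWith C α.toNNReal (peanoDrift α)) :=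
  ⟨fun _ hT => not_weakUniqueness hα hT,
    fun h0 => ⟨2, holderWith_peanoDrift h0 (by linarith)⟩⟩
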